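/- Let $\mathbb{D}=\{z\in\mathbb{C}:|z|<1\}$. For an open set $\Omega\subset\mathbb{C}$ let $A^2(\Omega)$ be the Bergman space of holomorphic functions on $\Omega$ that are square integrable with respect to Lebesgue measure, a Hilbert space as a closed subspace of $L^2(\Omega)$. For a nonempty open set $U\subset\mathbb{D}$ let $R_U:A^2(\mathbb{D})\to A^2(U)$, $R_Uf=f|_U$, be the restriction operator, and let $T_U=R_U^*R_U:A^2(\mathbb{D})\to A^2(\mathbb{D})$. Equip $\mathbb{D}$ with the Poincaré metric. A geodesic $\Gamma$ of $\mathbb{D}$ is the part in $\mathbb{D}$ of a Euclidean circle or straight line meeting $\partial\mathbb{D}$ orthogonally; its two endpoints divide $\partial\mathbb{D}$ into two arcs. A hypercycle with axis $\Gamma$ is the curve of all points of $\mathbb{D}$ at a fixed signed hyperbolic distance $t\in\mathbb{R}$ from $\Gamma$ (positive on one side of $\Gamma$, negative on the other); hypercycles with the same axis are coaxial. A hypercyclic crescent is the open region bounded by a hypercycle with axis $\Gamma$ and one of the two arcs of $\partial\mathbb{D}$, that is, the set of points of $\mathbb{D}$ whose signed distance from $\Gamma$ is greater than $t$, for some $t\in\mathbb{R}$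 and one of the two choices of sign. A hypercyclic lune is the open region between two distinct coaxial hypercycles, that is, the set of points of $\mathbb{D}$ whose signed distance from $\Gamma$ lies strictly between $s$ and $t$, for some real $s<t$. 1. If $U\subset\mathbb{D}$ is a hypercyclic crescent, then the spectrum of $T_U$ is the full interval $[0,1]$. 2. If $U\subset\mathbb{D}$ is a hypercyclic lune determined by two coaxial hypercycles, then the spectrum of $T_U$ is the interval $[0,\|T_U\|]$, and $0<\|T_U\|<1$. -/

import Mathlib

open MeasureTheory Set Filter Topology
open scoped ENNReal

noncomputable section

namespace Bergman

/-! ### Helper facts: the space of square integrable holomorphic functions is closed -/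

/-- The mean value inequality over a disc, up to a constant. -/
theorem mean_value_ineq {h : ℂ → ℂ} {z : ℂ} {r : ℝ} (hr : 0 < r)
    (hh : DifferentiableOn ℂ h (Metric.ball z r)) :
    ENNReal.ofReal (r / 2) * (ENNReal.ofReal (r / 2) * (ENNReal.ofReal (2 * Real.pi) * ‖h z‖ₑ))
      ≤ ∫⁻ w in Metric.ball z r, ‖h w‖ₑ := by
  have hcont : ContinuousOn h (Metric.ball z r) := hh.continuousOn
  -- the function, extended by zero and recentred
  set F : ℂ → ℝ≥0∞ := (Metric.ball z r).indicator (fun w => ‖h w‖ₑ) with hF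
  have hFm : Measurable F := by
    have : F = fun w => ‖(Metric.ball z r).indicator h w‖ₑ := by
      ext w
      by_cases hw : w ∈ Metric.ball z r <;> simp [hF, hw]
    rw [this]
    have h2 : Measurable ((Metric.ball z r).indicator h) := by
      classical
      rw [← Set.piecewise_eq_indicator]
      exact hcont.measurable_piecewise continuousOn_const Metric.isOpen_ball.measurableSet
    exact h2.enorm
  have h1 : ∫⁻ w in Metric.ball z r, ‖h w‖ₑ = ∫⁻ w, F (z + w) := by
    rw [lintegral_add_left_eq_self, hF, lintegral_indicator Metric.isOpen_ball.measurableSet]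
  have hsymm : Measurable (fun p : ℝ × ℝ => Complex.polarCoord.symm p) := by
    have : Continuous (fun p : ℝ × ℝ => Complex.polarCoord.symm p) := by
      simp only [Complex.polarCoord_symm_apply]
      fun_prop
    exact this.measurable
  rw [h1, ← Complex.lintegral_comp_polarCoord_symm, polarCoord_target,
    Measure.volume_eq_prod, ← Measure.prod_restrict, lintegral_prod _ (by
      apply Measurable.aemeasurable
      simp only [smul_eq_mul]
      exact Measurable.mul (by fun_prop) (hFm.comp (hsymm.const_add z)))]
  have key : ∀ ρ ∈ Ioo (r / 2) r, ENNReal.ofReal (r / 2) *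
      (ENNReal.ofReal (2 * Real.pi) * ‖h z‖ₑ) ≤
      ∫⁻ θ in Ioo (-Real.pi) Real.pi,
        ENNReal.ofReal ρ • F (z + Complex.polarCoord.symm (ρ, θ)) := by
    intro ρ hρ
    have hρ0 : 0 < ρ := by linarith [hρ.1]
    simp only [smul_eq_mul]
    rw [lintegral_const_mul]
    swap
    · exact hFm.comp ((hsymm.comp measurable_prodMk_left).const_add z)
    refine mul_le_mul' (ENNReal.ofReal_le_ofReal hρ.1.le) ?_
    have hpt : ∀ θ : ℝ, z + Complex.polarCoord.symm (ρ, θ) = circleMap z ρ θ := by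
      intro θ
      rw [Complex.polarCoord_symm_apply, circleMap, Complex.exp_mul_I]
      push_cast
      ring
    have hmem : ∀ θ : ℝ, circleMap z ρ θ ∈ Metric.ball z r := by
      intro θ
      have := circleMap_mem_sphere z hρ0.le θ
      rw [mem_sphere_iff_norm] at this
      rw [mem_ball_iff_norm, this]
      exact hρ.2
    have hval : ∀ θ : ℝ, F (z + Complex.polarCoord.symm (ρ, θ)) = ‖h (circleMap z ρ θ)‖ₑ := by
      intro θ
      rw [hpt, hF, indicator_of_mem (hmem θ)]
    simp only [hval]
    have havg : Real.circleAverage h z ρ = h z := by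
      apply DiffContOnCl.circleAverage
      apply DifferentiableOn.diffContOnCl
      apply hh.mono
      rw [abs_of_pos hρ0]
      exact Metric.closure_ball_subset_closedBall.trans
        (Metric.closedBall_subset_ball hρ.2)
    rw [Real.circleAverage_def] at havg
    have hper : Function.Periodic (fun θ => h (circleMap z ρ θ)) (2 * Real.pi) := by
      intro θ
      simp only [periodic_circleMap z ρ θ]
    have hint : ∫ θ in (0 : ℝ)..2 * Real.pi, h (circleMap z ρ θ)
        = ∫ θ in Ioo (-Real.pi) Real.pi, h (circleMap z ρ θ) := by
      have := hper.intervalIntegral_add_eq 0 (-Real.pi)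
      rw [zero_add] at this
      rw [this, show -Real.pi + 2 * Real.pi = Real.pi by ring,
        intervalIntegral.integral_of_le (by linarith [Real.pi_pos]), integral_Ioc_eq_integral_Ioo]
    rw [hint] at havg
    have hz : ‖∫ θ in Ioo (-Real.pi) Real.pi, h (circleMap z ρ θ)‖ₑ
        = ENNReal.ofReal (2 * Real.pi) * ‖h z‖ₑ := by
      have hpi : (2 * Real.pi : ℝ) ≠ 0 := by positivity
      have e : ∫ θ in Ioo (-Real.pi) Real.pi, h (circleMap z ρ θ) = (2 * Real.pi : ℝ) • h z := by
        rw [← havg, smul_smul, mul_inv_cancel₀ hpi, one_smul]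
      rw [e, enorm_smul, Real.enorm_eq_ofReal (by positivity)]
    rw [← hz]
    exact enorm_integral_le_lintegral_enorm _
  calc ENNReal.ofReal (r / 2) * (ENNReal.ofReal (r / 2) * (ENNReal.ofReal (2 * Real.pi) * ‖h z‖ₑ))
      = ∫⁻ _ in Ioo (r / 2) r, ENNReal.ofReal (r / 2) *
        (ENNReal.ofReal (2 * Real.pi) * ‖h z‖ₑ) := by
        rw [setLIntegral_const, Real.volume_Ioo, show r - r / 2 = r / 2 by ring, mul_comm]
    _ ≤ ∫⁻ ρ in Ioo (r / 2) r, ∫⁻ θ in Ioo (-Real.pi) Real.pi,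
        ENNReal.ofReal ρ • F (z + Complex.polarCoord.symm (ρ, θ)) :=
        setLIntegral_mono' measurableSet_Ioo key
    _ ≤ _ := lintegral_mono_set (fun ρ hρ => by
        have := hρ.1
        simp only [mem_Ioi]
        linarith)

/-- Point evaluations are controlled by the `L²` norm. -/
theorem enorm_sq_le {g : ℂ → ℂ} {z : ℂ} {r : ℝ} (hr : 0 < r)
    (hg : DifferentiableOn ℂ g (Metric.ball z r)) :
    ENNReal.ofReal (r / 2 * (r / 2) * (2 * Real.pi)) * ‖g z‖ₑ ^ 2
      ≤ ∫⁻ w in Metric.ball z r, ‖g w‖ₑ ^ 2 := by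
  have := mean_value_ineq hr (hg.pow 2)
  simp only [Pi.pow_apply, enorm_pow] at this
  refine le_trans (le_of_eq ?_) this
  rw [ENNReal.ofReal_mul (by positivity), ENNReal.ofReal_mul (by positivity)]
  ring

/-! ### Bergman spaces and restriction operators -/

/-- The Bergman space `A²(Ω)` of an open set `Ω ⊆ ℂ`: the subspace of `L²(Ω)` (Lebesgue measure)
formed by the (classes of) square integrable functions which are holomorphic on `Ω`. -/
def A2 (Ω : TopologicalSpace.Opens ℂ) :
    Submodule ℂ (Lp ℂ 2 ((volume : Measure ℂ).restrict (Ω : Set ℂ))) where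
  carrier := {f | ∃ g : ℂ → ℂ, DifferentiableOn ℂ g (Ω : Set ℂ) ∧
    f =ᵐ[(volume : Measure ℂ).restrict (Ω : Set ℂ)] g}
  zero_mem' := ⟨0, differentiableOn_const 0, Lp.coeFn_zero ℂ 2 _⟩
  add_mem' := by
    rintro f₁ f₂ ⟨g₁, h₁, e₁⟩ ⟨g₂, h₂, e₂⟩
    exact ⟨g₁ + g₂, h₁.add h₂, (Lp.coeFn_add f₁ f₂).trans (e₁.add e₂)⟩
  smul_mem' := by
    rintro c f ⟨g, h, e⟩
    exact ⟨c • g, h.const_smul c, (Lp.coeFn_smul c f).trans (e.const_smul c)⟩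

theorem isClosed_A2 (Ω : TopologicalSpace.Opens ℂ) :
    IsClosed (A2 Ω : Set (Lp ℂ 2 ((volume : Measure ℂ).restrict (Ω : Set ℂ)))) := by
  apply IsSeqClosed.isClosed
  intro f f₀ hf hlim
  choose g hg hfg using hf
  -- distances between representatives
  have hdist : ∀ n m, ∫⁻ w in (Ω : Set ℂ), ‖g n w - g m w‖ₑ ^ 2 = ‖f n - f m‖ₑ ^ 2 := by
    intro n m
    have h2 := eLpNorm_nnreal_pow_eq_lintegral (μ := (volume : Measure ℂ).restrict (Ω : Set ℂ))
      (f := (f n - f m : Lp ℂ 2 _)) (p := 2) (by norm_num)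
    rw [Lp.enorm_def]
    have h3 : ∫⁻ w in (Ω : Set ℂ), ‖g n w - g m w‖ₑ ^ 2
        = ∫⁻ w in (Ω : Set ℂ), ‖(f n - f m : Lp ℂ 2 _) w‖ₑ ^ (((2 : NNReal) : ℝ)) := by
      apply lintegral_congr_ae
      filter_upwards [Lp.coeFn_sub (f n) (f m), hfg n, hfg m] with w h h' h''
      rw [h, Pi.sub_apply, h', h'']
      simp
    rw [h3, ← h2]
    simp
  have hcau : CauchySeq f := hlim.cauchySeq
  -- locally uniform Cauchy estimate
  have hloc : ∀ x ∈ (Ω : Set ℂ), ∃ r > 0, Metric.ball x r ⊆ (Ω : Set ℂ) ∧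
      UniformCauchySeqOn g atTop (Metric.ball x r) := by
    intro x hx
    obtain ⟨R, hR, hRsub⟩ := Metric.isOpen_iff.1 Ω.isOpen x hx
    have hr : 0 < R / 2 := by linarith
    refine ⟨R / 2, hr, (Metric.ball_subset_ball (by linarith)).trans hRsub, ?_⟩
    set C : ℝ := R / 2 / 2 * (R / 2 / 2) * (2 * Real.pi) with hC
    have hCpos : 0 < C := by positivity
    have hest : ∀ n m, ∀ z ∈ Metric.ball x (R / 2), C * ‖g n z - g m z‖ ^ 2 ≤ ‖f n - f m‖ ^ 2 := by
      intro n m z hz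
      have hsub : Metric.ball z (R / 2) ⊆ (Ω : Set ℂ) := by
        refine Set.Subset.trans (Metric.ball_subset_ball' ?_) hRsub
        rw [Metric.mem_ball] at hz
        linarith
      have h1 := enorm_sq_le (g := fun w => g n w - g m w) hr
        (((hg n).sub (hg m)).mono hsub)
      have h2 := h1.trans ((lintegral_mono_set hsub).trans (hdist n m).le)
      rw [← ofReal_norm, ← ofReal_norm, ← ENNReal.ofReal_pow (norm_nonneg _),
        ← ENNReal.ofReal_pow (norm_nonneg _), ← ENNReal.ofReal_mul hCpos.le,
        ENNReal.ofReal_le_ofReal_iff (by positivity)] at h2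
      exact h2
    rw [Metric.uniformCauchySeqOn_iff]
    intro ε hε
    obtain ⟨N, hN⟩ := Metric.cauchySeq_iff.1 hcau (Real.sqrt C * ε) (by positivity)
    refine ⟨N, fun n hn m hm z hz => ?_⟩
    have h1 := hest n m z hz
    have h2 := hN n hn m hm
    rw [dist_eq_norm] at h2 ⊢
    by_contra hcon
    push Not at hcon
    have h3 : ‖f n - f m‖ ^ 2 < (Real.sqrt C * ε) ^ 2 :=
      pow_lt_pow_left₀ h2 (norm_nonneg _) two_ne_zero
    rw [mul_pow, Real.sq_sqrt hCpos.le] at h3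
    have h4 : C * ε ^ 2 ≤ C * ‖g n z - g m z‖ ^ 2 := by gcongr
    linarith
  have hpt : ∀ z ∈ (Ω : Set ℂ), ∃ l, Tendsto (fun n => g n z) atTop (𝓝 l) := by
    intro z hz
    obtain ⟨r, hr, -, hu⟩ := hloc z hz
    exact cauchySeq_tendsto_of_complete (hu.cauchy_map (Metric.mem_ball_self hr))
  choose! G hG using hpt
  have hTL : TendstoLocallyUniformlyOn g G atTop (Ω : Set ℂ) := by
    intro u hu x hx
    obtain ⟨r, hr, hsub, hc⟩ := hloc x hx
    have := hc.tendstoUniformlyOn_of_tendsto (fun z hz => hG z (hsub hz))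
    exact ⟨Metric.ball x r, mem_nhdsWithin_of_mem_nhds (Metric.ball_mem_nhds x hr), this u hu⟩
  refine ⟨G, hTL.differentiableOn (Eventually.of_forall hg) Ω.isOpen, ?_⟩
  obtain ⟨ns, hns, hae⟩ := (tendstoInMeasure_of_tendsto_Lp hlim).exists_seq_tendsto_ae
  filter_upwards [hae, ae_all_iff.2 hfg, ae_restrict_mem Ω.isOpen.measurableSet] with z h1 h2 h3
  refine tendsto_nhds_unique h1 ?_
  simp only [h2]
  exact (hG z h3).comp hns.tendsto_atTop

instance (Ω : TopologicalSpace.Opens ℂ) : CompleteSpace (A2 Ω) :=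
  (isClosed_A2 Ω).completeSpace_coe

/-- The restriction operator `R_U : A²(Ω) → A²(U)`, `R_U f = f|_U`, for open sets `U ⊆ Ω`. -/
def restrictionOp {Ω U : TopologicalSpace.Opens ℂ} (h : U ≤ Ω) : A2 Ω →L[ℂ] A2 U :=
  LinearMap.mkContinuous
    { toFun := fun f =>
        ⟨((Lp.memLp f.1).mono_measure (Measure.restrict_mono h le_rfl)).toLp (f.1 : ℂ → ℂ), by
          obtain ⟨g, hg, hfg⟩ := f.2
          exact ⟨g, hg.mono h, (MemLp.coeFn_toLp _).trans
            (ae_mono (Measure.restrict_mono h le_rfl) hfg)⟩⟩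
      map_add' := fun f₁ f₂ => by
        apply Subtype.ext
        simp only [Submodule.coe_add, AddMemClass.mk_add_mk]
        rw [← MemLp.toLp_add]
        exact MemLp.toLp_congr _ _
          (ae_mono (Measure.restrict_mono h le_rfl) (Lp.coeFn_add f₁.1 f₂.1))
      map_smul' := fun c f => by
        apply Subtype.ext
        simp only [Submodule.coe_smul, RingHom.id_apply]
        rw [← MemLp.toLp_const_smul]
        exact MemLp.toLp_congr _ _
          (ae_mono (Measure.restrict_mono h le_rfl) (Lp.coeFn_smul c f.1)) }
    1 (fun f => by
      change ‖((Lp.memLp f.1).mono_measure (Measure.restrict_mono h le_rfl)).toLp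
        (f.1 : ℂ → ℂ)‖ ≤ 1 * ‖f.1‖
      rw [one_mul, Lp.norm_toLp, Lp.norm_def]
      exact ENNReal.toReal_mono (Lp.eLpNorm_ne_top _)
        (eLpNorm_mono_measure _ (Measure.restrict_mono h le_rfl)))

/-- The operator `T_U = R_U^* R_U` on `A²(Ω)`. -/
def toeplitzOp {Ω U : TopologicalSpace.Opens ℂ} (h : U ≤ Ω) : A2 Ω →L[ℂ] A2 Ω :=
  (ContinuousLinearMap.adjoint (restrictionOp h)).comp (restrictionOp h)

/-- The unit disc `𝔻`. -/
def disc : TopologicalSpace.Opens ℂ := ⟨Metric.ball 0 1, Metric.isOpen_ball⟩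

/-! ### Hypercycles in the Poincaré disc -/

/-- The distance of the Poincaré metric `4|dz|² / (1 - |z|²)²` between points of `𝔻`:
`sinh (d / 2) = |z - w| / √((1 - |z|²) (1 - |w|²))`. -/
def hypDist (z w : ℂ) : ℝ :=
  2 * Real.arsinh (‖z - w‖ / Real.sqrt ((1 - ‖z‖ ^ 2) * (1 - ‖w‖ ^ 2)))

/-- The hyperbolic distance from a point of `𝔻` to a nonempty subset of `𝔻`. -/
def hypInfDist (z : ℂ) (Γ : Set ℂ) : ℝ := sInf ((fun w => hypDist z w) '' Γ)

/-- A (complete) hyperbolic geodesic of the Poincaré disc: the part in `𝔻` of a Euclidean circle or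
straight line which meets the unit circle orthogonally. The circle with centre `c` and radius
`r > 0` is orthogonal to the unit circle iff `|c|² = 1 + r²`; a line is iff it passes through `0`
(here it is spanned by `u ≠ 0`). -/
def IsGeodesic (Γ : Set ℂ) : Prop :=
  (∃ (c : ℂ) (r : ℝ), 0 < r ∧ ‖c‖ ^ 2 = 1 + r ^ 2 ∧ Γ = {z | z ∈ disc ∧ ‖z - c‖ = r}) ∨
  (∃ u : ℂ, u ≠ 0 ∧ Γ = {z | z ∈ disc ∧ ∃ t : ℝ, z = t * u})

/-- `S` is one of the two sides of the geodesic `Γ`, i.e. a connected component of `𝔻 \ Γ`. -/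
def IsSide (Γ S : Set ℂ) : Prop :=
  ∃ w ∈ (disc : Set ℂ) \ Γ, S = connectedComponentIn ((disc : Set ℂ) \ Γ) w

open Classical in
/-- The signed hyperbolic distance from the geodesic `Γ`, positive on its side `S`. -/
def signedDist (Γ S : Set ℂ) (z : ℂ) : ℝ :=
  if z ∈ S then hypInfDist z Γ else -hypInfDist z Γ

/-- A hypercyclic crescent: the region between a hypercycle with axis `Γ`, i.e. the curve of the
points of `𝔻` at a fixed signed distance `t` from `Γ`, and one of the two arcs into which the ideal
endpoints of `Γ` divide the unit circle, namely the arc bordering the side `S`. As `S` may be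
either side of `Γ`, both arcs are covered. -/
def IsHypercyclicCrescent (U : Set ℂ) : Prop :=
  ∃ (Γ S : Set ℂ) (t : ℝ), IsGeodesic Γ ∧ IsSide Γ S ∧ U = {z | z ∈ disc ∧ t < signedDist Γ S z}

/-- A hypercyclic lune: the region between two (distinct) coaxial hypercycles, i.e. between the
curves of points of `𝔻` at signed distances `s < t` from a common axis `Γ`. -/
def IsHypercyclicLune (U : Set ℂ) : Prop :=
  ∃ (Γ S : Set ℂ) (s t : ℝ), IsGeodesic Γ ∧ IsSide Γ S ∧ s < t ∧
    U = {z | z ∈ disc ∧ s < signedDist Γ S z ∧ signedDist Γ S z < t}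

end Bergman

end

/-!
Every hypercyclic crescent or lune is, in suitable conformal coordinates, a substrip of a horizontal
strip. A geodesic is determined by a unit normal vector `(A, c)`, `|c|² = 1 + A²`, of the
hyperboloid model; the function `sinhDist A c` is the hyperbolic sine of the signed distance from
it, and the logarithm `toStrip A c` of a Möbius transformation maps the disc onto the strip
`|Im w| < π / 2`, the geodesic onto the real axis, and satisfies `sinhDist A c = tan (Im w)`
(`arctan_sinhDist`, `hypInfDist_eq`, `exists_signedDist_eq`). So hypercycles become horizontal
lines, and `U` becomes a strip `a < Im w < b`, with `b = π / 2` for a crescent.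

Bergman functions are transported by `G ↦ (G ∘ Ψ) Ψ'`, which preserves square integrals. On the
strip, horizontal translations act, and the Fourier transform `φ` of `G|_ℝ` diagonalizes the
problem: by Cauchy's theorem the Fourier transform of `G` on the line at height `y` is
`e^{-2πξy} φ(ξ)`, so by Plancherel's theorem
`∫_{a < Im w < b} |G|² = ∫ |φ(ξ)|² (∫ₐᵇ e^{-4πξy} dy) dξ` (`lintegral_strip_enorm_sq`). Hence
`T_U` is multiplication by the quotient `m = u / s` of the weights of the small and of the large strip.
Only the functions `G` with Gaussian decay are represented; they are dense, and it is
not necessary to know the range of the representation: `IsSpectralRep.norm_sub_sq_le` bounds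
`‖(T_U - λ) f‖` by the norm of `(m - λ) φ`, and testing with Gaussians `φ` concentrated at `ξ` shows
that `m(ξ)` is in the spectrum (`IsSpectralRep.div_mem_spectrum`), while `‖T_U‖ ≤ sup m`.

Finally `m` is continuous. For a crescent it tends to `0` at `+∞` and to `1` at `-∞`. For a lune
it tends to `0` at both ends and is less than `1` everywhere, so that `‖T_U‖ = max m`. The
intermediate value theorem gives the full intervals.
-/

open scoped FourierTransform ComplexConjugate

namespace Bergman

/-! ### Fourier analysis of holomorphic functions on a strip -/

theorem enorm_sq_eq_ofReal {E : Type*} [SeminormedAddGroup E] (z : E) :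
    ‖z‖ₑ ^ 2 = ENNReal.ofReal (‖z‖ ^ 2) := by
  rw [ENNReal.ofReal_pow (norm_nonneg _), ofReal_norm]

/-- The open horizontal strip `a < Im w < b`. -/
def strip (a b : ℝ) : Set ℂ := Complex.im ⁻¹' Ioo a b

theorem isOpen_strip (a b : ℝ) : IsOpen (strip a b) := isOpen_Ioo.preimage Complex.continuous_im

/-- Gaussian decay in the real direction, uniformly on the closed substrips of `|Im w| < c`. -/
def GaussianDecay (c : ℝ) (G : ℂ → ℂ) : Prop :=
  ∀ r < c, ∃ K δ : ℝ, 0 < δ ∧ ∀ w : ℂ, |w.im| ≤ r → ‖G w‖ ≤ K * Real.exp (-δ * w.re ^ 2)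

theorem mem_strip_symm {c : ℝ} {w : ℂ} : w ∈ strip (-c) c ↔ |w.im| < c := by
  simp [strip, abs_lt]

theorem mk_mem_strip {c x y : ℝ} (hy : |y| < c) : (x + y * Complex.I : ℂ) ∈ strip (-c) c := by
  rw [mem_strip_symm]; simpa using hy

/-- The restriction of a function to the horizontal line at height `y`. -/
def line (G : ℂ → ℂ) (y : ℝ) : ℝ → ℂ := fun x => G (x + y * Complex.I)

section Line

variable {c : ℝ} {G : ℂ → ℂ}

theorem continuous_line (hG : DifferentiableOn ℂ G (strip (-c) c)) {y : ℝ} (hy : |y| < c) :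
    Continuous (line G y) :=
  hG.continuousOn.comp_continuous (by fun_prop) fun _ => mk_mem_strip hy

theorem integrable_line (hG : DifferentiableOn ℂ G (strip (-c) c)) (hd : GaussianDecay c G)
    {y : ℝ} (hy : |y| < c) : Integrable (line G y) := by
  obtain ⟨K, δ, hδ, hK⟩ := hd _ hy
  refine ((integrable_exp_neg_mul_sq hδ).const_mul K).mono'
    (continuous_line hG hy).aestronglyMeasurable (Eventually.of_forall fun x => ?_)
  simpa [line] using hK (x + y * Complex.I) (by simp)

/-- Cauchy's theorem: the integral over a horizontal line does not depend on the line. -/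
theorem integral_line_eq (hG : DifferentiableOn ℂ G (strip (-c) c)) (hd : GaussianDecay c G)
    {y : ℝ} (hy : |y| < c) : ∫ x, line G y x = ∫ x, line G 0 x := by
  have hc : 0 < c := (abs_nonneg y).trans_lt hy
  have h0 : |(0 : ℝ)| < c := by simpa
  obtain ⟨K, δ, hδ, hK⟩ := hd _ hy
  have hrect : ∀ T : ℝ, (∫ x in -T..T, line G y x) - ∫ x in -T..T, line G 0 x
      = Complex.I * ((∫ t in 0..y, G (T + t * Complex.I))
        - ∫ t in 0..y, G (-T + t * Complex.I)) := by
    intro T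
    have := Complex.integral_boundary_rect_eq_zero_of_differentiableOn G (-T) (T + y * Complex.I)
      (hG.mono ?_)
    · simp only [Complex.neg_im, Complex.ofReal_im, neg_zero, Complex.ofReal_zero, zero_mul,
        add_zero, Complex.neg_re, Complex.ofReal_re, Complex.add_re, Complex.mul_re,
        Complex.I_re, mul_zero, Complex.I_im, Complex.add_im, Complex.mul_im,
        mul_one, zero_add, smul_eq_mul, Complex.ofReal_neg, sub_self] at this
      simp only [line, Complex.ofReal_zero, zero_mul, add_zero]
      linear_combination -this
    · rintro w ⟨-, hw⟩
      rw [mem_strip_symm]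
      simp only [Complex.neg_im, Complex.ofReal_im, neg_zero, Complex.add_im, Complex.mul_im,
        Complex.ofReal_re, Complex.I_im, mul_one, Complex.I_re, mul_zero, add_zero, zero_add,
        mem_preimage] at hw
      have := abs_sub_left_of_mem_uIcc hw
      simp only [sub_zero] at this
      exact this.trans_lt hy
  have hside : ∀ σ : ℝ, |σ| = 1 →
      Tendsto (fun T : ℝ => ∫ t in 0..y, G ((σ * T : ℝ) + t * Complex.I)) atTop (𝓝 0) := by
    intro σ hσ
    have hb : ∀ T : ℝ, ‖∫ t in 0..y, G ((σ * T : ℝ) + t * Complex.I)‖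
        ≤ K * Real.exp (-δ * T ^ 2) * |y - 0| := by
      intro T
      apply intervalIntegral.norm_integral_le_of_norm_le_const
      intro t ht
      have h1 := hK ((σ * T : ℝ) + t * Complex.I) (by
        have := abs_sub_left_of_mem_uIcc (uIoc_subset_uIcc ht)
        simpa using this)
      have h2 : σ ^ 2 = 1 := by rw [← sq_abs, hσ, one_pow]
      simpa [mul_pow, h2] using h1
    refine squeeze_zero_norm hb ?_
    have : Tendsto (fun T : ℝ => Real.exp (-δ * T ^ 2)) atTop (𝓝 0) := by
      refine Real.tendsto_exp_atBot.comp ?_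
      simp only [neg_mul]
      exact tendsto_neg_atTop_atBot.comp ((tendsto_pow_atTop two_ne_zero).const_mul_atTop hδ)
    simpa using (this.const_mul K).mul_const |y - 0|
  have hlim := ((intervalIntegral_tendsto_integral (integrable_line hG hd hy)
    tendsto_neg_atTop_atBot tendsto_id).sub (intervalIntegral_tendsto_integral
      (integrable_line hG hd h0) tendsto_neg_atTop_atBot tendsto_id))
  have hlim2 := ((hside 1 (by simp)).sub (hside (-1) (by simp))).const_mul Complex.I
  simp only [id, hrect] at hlim
  simp only [one_mul, neg_mul, Complex.ofReal_neg, sub_zero, mul_zero] at hlim2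
  exact sub_eq_zero.1 (tendsto_nhds_unique hlim hlim2)

/-- Gaussian decay is stable under factors bounded on closed substrips, such as exponentials. -/
theorem GaussianDecay.mul_bounded {F : ℂ → ℂ} (hd : GaussianDecay c G)
    (hF : ∀ r < c, ∃ K, ∀ w : ℂ, |w.im| ≤ r → ‖F w‖ ≤ K) :
    GaussianDecay c fun w => F w * G w := by
  intro r hr
  obtain ⟨K, δ, hδ, hK⟩ := hd r hr
  obtain ⟨M, hM⟩ := hF r hr
  refine ⟨M * K, δ, hδ, fun w hw => ?_⟩
  rw [norm_mul, mul_assoc]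
  exact mul_le_mul (hM w hw) (hK w hw) (norm_nonneg _) ((norm_nonneg _).trans (hM w hw))

theorem GaussianDecay.add {F : ℂ → ℂ} (hd : GaussianDecay c G) (hF : GaussianDecay c F) :
    GaussianDecay c (G + F) := by
  intro r hr
  obtain ⟨K, δ, hδ, hK⟩ := hd r hr
  obtain ⟨M, ε, hε, hM⟩ := hF r hr
  refine ⟨|K| + |M|, min δ ε, lt_min hδ hε, fun w hw => (norm_add_le _ _).trans ?_⟩
  rw [add_mul]
  gcongr
  · refine (hK w hw).trans ?_
    gcongr
    · exact le_abs_self K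
    · exact min_le_left _ _
  · refine (hM w hw).trans ?_
    gcongr
    · exact le_abs_self M
    · exact min_le_right _ _

theorem GaussianDecay.neg (hd : GaussianDecay c G) : GaussianDecay c (-G) := by
  simpa [GaussianDecay] using hd

/-- The Fourier transforms of a strip function on different lines differ by an exponential. -/
theorem fourier_line (hG : DifferentiableOn ℂ G (strip (-c) c)) (hd : GaussianDecay c G)
    {y : ℝ} (hy : |y| < c) (ξ : ℝ) :
    𝓕 (line G y) ξ = Real.exp (-(2 * Real.pi * ξ * y)) * 𝓕 (line G 0) ξ := by
  set F : ℂ → ℂ := fun w => Complex.exp (-(2 * Real.pi * ξ * Complex.I) * w) with hF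
  have hnorm : ∀ w, ‖F w‖ = Real.exp (2 * Real.pi * ξ * w.im) := by
    intro w
    rw [hF, Complex.norm_exp]
    congr 1
    simp
  have hFd : Differentiable ℂ F := by fun_prop
  have hint := integral_line_eq (G := fun w => F w * G w) (hFd.differentiableOn.mul hG)
    (hd.mul_bounded fun r _ => ⟨Real.exp (2 * Real.pi * |ξ| * r), fun w hw => by
      rw [hnorm, Real.exp_le_exp]
      calc 2 * Real.pi * ξ * w.im ≤ |2 * Real.pi * ξ * w.im| := le_abs_self _
        _ = 2 * Real.pi * |ξ| * |w.im| := by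
          rw [abs_mul, abs_mul, abs_of_pos (by positivity : 0 < 2 * Real.pi)]
        _ ≤ 2 * Real.pi * |ξ| * r := by gcongr⟩) hy
  have e : ∀ t : ℝ, ∫ x, line (fun w => F w * G w) t x
      = Real.exp (2 * Real.pi * ξ * t) * 𝓕 (line G t) ξ := by
    intro t
    rw [Real.fourier_real_eq_integral_exp_smul, ← integral_const_mul]
    congr 1
    ext x
    simp only [line, hF, smul_eq_mul]
    rw [← mul_assoc]
    congr 1
    rw [Complex.ofReal_exp, ← Complex.exp_add]
    congr 1
    push_cast
    linear_combination (-2 * Real.pi * ξ * t : ℂ) * Complex.I_sq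
  rw [e, e] at hint
  simp only [mul_zero, Real.exp_zero, Complex.ofReal_one, one_mul] at hint
  rw [← hint, ← mul_assoc, ← Complex.ofReal_mul, ← Real.exp_add]
  simp

/-- Comparison with the lines at heights `±r` gives exponential decay of the Fourier transform. -/
theorem norm_fourier_line_le (hG : DifferentiableOn ℂ G (strip (-c) c)) (hd : GaussianDecay c G)
    {r : ℝ} (hr0 : 0 ≤ r) (hr : r < c) : ∃ K, ∀ ξ, ‖𝓕 (line G 0) ξ‖
      ≤ K * Real.exp (-(2 * Real.pi * r * |ξ|)) := by
  have key : ∀ y : ℝ, |y| < c → ∀ ξ, ‖𝓕 (line G 0) ξ‖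
      ≤ (∫ x, ‖line G y x‖) * Real.exp (2 * Real.pi * ξ * y) := by
    intro y hy ξ
    have h1 : ‖𝓕 (line G y) ξ‖ ≤ ∫ x, ‖line G y x‖ :=
      VectorFourier.norm_fourierIntegral_le_integral_norm _ _ _ _ _
    rw [fourier_line hG hd hy, norm_mul, Complex.norm_real, Real.norm_eq_abs,
      abs_of_pos (Real.exp_pos _), Real.exp_neg] at h1
    rw [← div_le_iff₀ (Real.exp_pos _), div_eq_inv_mul]
    exact h1
  refine ⟨max (∫ x, ‖line G r x‖) (∫ x, ‖line G (-r) x‖), fun ξ => ?_⟩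
  rcases le_total 0 ξ with h | h
  · refine (key (-r) (by rwa [abs_neg, abs_of_nonneg hr0]) ξ).trans ?_
    rw [abs_of_nonneg h]
    gcongr
    · exact le_max_right _ _
    · linarith
  · refine (key r (by rwa [abs_of_nonneg hr0]) ξ).trans ?_
    rw [abs_of_nonpos h]
    gcongr
    · exact le_max_left _ _
    · linarith

theorem integrable_exp_neg_mul_abs {b : ℝ} (hb : 0 < b) :
    Integrable fun x : ℝ => Real.exp (-(b * |x|)) := by
  rw [← integrableOn_univ, ← Iic_union_Ioi (a := (0 : ℝ))]
  refine IntegrableOn.union ?_ ?_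
  · refine (integrableOn_exp_mul_Iic hb 0).congr_fun (fun x hx => ?_) measurableSet_Iic
    simp only [abs_of_nonpos (mem_Iic.1 hx), mul_neg, neg_neg]
  · refine (integrableOn_exp_mul_Ioi (neg_lt_zero.2 hb) 0).congr_fun (fun x hx => ?_)
      measurableSet_Ioi
    simp only [abs_of_pos (mem_Ioi.1 hx), neg_mul]

theorem continuous_fourier_line (hG : DifferentiableOn ℂ G (strip (-c) c))
    (hd : GaussianDecay c G) {y : ℝ} (hy : |y| < c) : Continuous (𝓕 (line G y)) :=
  VectorFourier.fourierIntegral_continuous Real.continuous_fourierChar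
    (by exact continuous_inner (𝕜 := ℝ) (E := ℝ)) (integrable_line hG hd hy)

theorem integrable_fourier_line (hG : DifferentiableOn ℂ G (strip (-c) c))
    (hd : GaussianDecay c G) {y : ℝ} (hy : |y| < c) : Integrable (𝓕 (line G y)) := by
  obtain ⟨r, hyr, hrc⟩ := exists_between hy
  have hr0 : 0 ≤ r := (abs_nonneg y).trans hyr.le
  obtain ⟨K, hK⟩ := norm_fourier_line_le hG hd hr0 hrc
  have hb : 0 < 2 * Real.pi * (r - |y|) := by
    have := Real.pi_pos
    have : 0 < r - |y| := by linarith
    positivity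
  refine ((integrable_exp_neg_mul_abs hb).const_mul K).mono'
    (continuous_fourier_line hG hd hy).aestronglyMeasurable (Eventually.of_forall fun ξ => ?_)
  rw [fourier_line hG hd hy, norm_mul, Complex.norm_real, Real.norm_eq_abs,
    abs_of_pos (Real.exp_pos _)]
  have hK0 : 0 ≤ K := by simpa using (norm_nonneg _).trans (hK 0)
  calc Real.exp (-(2 * Real.pi * ξ * y)) * ‖𝓕 (line G 0) ξ‖
      ≤ Real.exp (2 * Real.pi * |ξ| * |y|) * (K * Real.exp (-(2 * Real.pi * r * |ξ|))) := by
        gcongr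
        · calc -(2 * Real.pi * ξ * y) ≤ |2 * Real.pi * ξ * y| := neg_le_abs _
            _ = 2 * Real.pi * |ξ| * |y| := by
              rw [abs_mul, abs_mul, abs_of_pos (by positivity : 0 < 2 * Real.pi)]
        · exact hK ξ
    _ = K * Real.exp (-(2 * Real.pi * (r - |y|) * |ξ|)) := by
        rw [mul_left_comm, ← Real.exp_add]
        congr 2
        ring

/-- **Plancherel's theorem** for a continuous integrable function with integrable Fourier
transform. -/
theorem integral_norm_sq_fourier_eq {g : ℝ → ℂ} (hc : Continuous g) (hg : Integrable g)
    (hg' : Integrable (𝓕 g)) : ∫ ξ, ‖𝓕 g ξ‖ ^ 2 = ∫ x, ‖g x‖ ^ 2 := by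
  have h := VectorFourier.integral_sesq_fourierIntegral_eq_neg_flip (innerSL ℂ)
    (L := innerₗ ℝ) Real.continuous_fourierChar continuous_inner hg hg'
  have hinv : VectorFourier.fourierIntegral Real.fourierChar volume (-(innerₗ ℝ).flip)
      (𝓕 g) = g := by
    rw [flip_innerₗ]
    exact hc.fourierInv_fourier_eq hg hg'
  rw [hinv] at h
  change ∫ ξ, inner ℂ (𝓕 g ξ) (𝓕 g ξ) = ∫ x, inner ℂ (g x) (g x) at h
  apply Complex.ofRealLI.injective
  simpa [← LinearIsometry.integral_comp_comm, inner_self_eq_norm_sq_to_K] using h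

theorem lintegral_enorm_sq_fourier_eq {g : ℝ → ℂ} (hc : Continuous g) (hg : Integrable g)
    (hg2 : Integrable fun x => ‖g x‖ ^ 2) (hg' : Integrable (𝓕 g)) :
    ∫⁻ ξ, ‖𝓕 g ξ‖ₑ ^ 2 = ∫⁻ x, ‖g x‖ₑ ^ 2 := by
  have hg2' : Integrable fun ξ => ‖𝓕 g ξ‖ ^ 2 := by
    refine (hg'.norm.const_mul (∫ x, ‖g x‖)).mono' (hg'.aestronglyMeasurable.norm.pow 2)
      (Eventually.of_forall fun ξ => ?_)
    rw [Real.norm_of_nonneg (by positivity), sq]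
    gcongr
    exact VectorFourier.norm_fourierIntegral_le_integral_norm _ _ _ _ _
  simp only [enorm_sq_eq_ofReal]
  rw [← ofReal_integral_eq_lintegral_ofReal hg2' (Eventually.of_forall fun _ => by positivity),
    ← ofReal_integral_eq_lintegral_ofReal hg2 (Eventually.of_forall fun _ => by positivity),
    integral_norm_sq_fourier_eq hc hg hg']

theorem integrable_line_sq (hG : DifferentiableOn ℂ G (strip (-c) c)) (hd : GaussianDecay c G)
    {y : ℝ} (hy : |y| < c) : Integrable fun x => ‖line G y x‖ ^ 2 := by
  obtain ⟨K, δ, hδ, hK⟩ := hd _ hy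
  refine ((integrable_line hG hd hy).norm.const_mul K).mono'
    ((continuous_line hG hy).norm.pow 2).aestronglyMeasurable (Eventually.of_forall fun x => ?_)
  rw [Real.norm_of_nonneg (by positivity), sq]
  gcongr
  have := hK (x + y * Complex.I) (by simp)
  refine this.trans (mul_le_of_le_one_right ?_ ?_)
  · by_contra! hK0
    have := (norm_nonneg _).trans (hK 0 (by simp))
    simp at this
    linarith
  · exact Real.exp_le_one_iff.2 (by nlinarith [sq_nonneg (x + y * Complex.I : ℂ).re])

theorem lintegral_line_sq (hG : DifferentiableOn ℂ G (strip (-c) c)) (hd : GaussianDecay c G)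
    {y : ℝ} (hy : |y| < c) : ∫⁻ x, ‖line G y x‖ₑ ^ 2
      = ∫⁻ ξ, ‖𝓕 (line G 0) ξ‖ₑ ^ 2 * ENNReal.ofReal (Real.exp (-(4 * Real.pi * ξ * y))) := by
  rw [← lintegral_enorm_sq_fourier_eq (continuous_line hG hy) (integrable_line hG hd hy)
    (integrable_line_sq hG hd hy) (integrable_fourier_line hG hd hy)]
  congr 1
  ext ξ
  rw [fourier_line hG hd hy, enorm_mul, mul_pow, mul_comm]
  congr 1
  rw [← ofReal_norm, Complex.norm_real, Real.norm_of_nonneg (Real.exp_pos _).le,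
    ← ENNReal.ofReal_pow (Real.exp_pos _).le, ← Real.exp_nat_mul]
  congr 2
  push_cast
  ring

end Line

/-- The weight `∫ₐᵇ e^{-4πξy} dy`: the squared `L²` norm on the strip `a < Im w < b`, per unit
spectral mass, of the frequency `ξ`. -/
noncomputable def stripWeight (a b ξ : ℝ) : ℝ := ∫ y in a..b, Real.exp (-(4 * Real.pi * ξ * y))

theorem ofReal_stripWeight {a b : ℝ} (hab : a ≤ b) (ξ : ℝ) : ENNReal.ofReal (stripWeight a b ξ)
    = ∫⁻ y in Ioo a b, ENNReal.ofReal (Real.exp (-(4 * Real.pi * ξ * y))) := by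
  rw [stripWeight, intervalIntegral.integral_of_le hab, integral_Ioc_eq_integral_Ioo,
    ofReal_integral_eq_lintegral_ofReal _ (Eventually.of_forall fun _ => (Real.exp_pos _).le)]
  exact (Continuous.integrableOn_Icc (by fun_prop)).mono_set Ioo_subset_Icc_self

/-- Integration over a strip, one horizontal line after the other. -/
theorem setLIntegral_strip {a b : ℝ} {f : ℂ → ℝ≥0∞}
    (hf : AEMeasurable f (volume.restrict (strip a b))) :
    ∫⁻ w in strip a b, f w = ∫⁻ y in Ioo a b, ∫⁻ x : ℝ, f (x + y * Complex.I) := by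
  set e := Complex.measurableEquivRealProd.symm
  have he : MeasurePreserving e volume volume := Complex.volume_preserving_equiv_real_prod.symm
  have hpre : e ⁻¹' strip a b = univ ×ˢ Ioo a b := by
    ext p
    simp [e, strip]
  have her := he.restrict_preimage (isOpen_strip a b).measurableSet
  rw [← her.lintegral_comp_emb e.measurableEmbedding, hpre, Measure.volume_eq_prod,
    ← Measure.prod_restrict, Measure.restrict_univ, lintegral_prod_symm]
  · simp [e, Complex.mk_eq_add_mul_I]
  · have := hf.comp_quasiMeasurePreserving her.quasiMeasurePreserving
    rw [hpre, Measure.volume_eq_prod, ← Measure.prod_restrict, Measure.restrict_univ] at this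
    exact this

/-- **Paley–Wiener identity**: the `L²` norm over a substrip in terms of the Fourier transform
of the restriction to the real line. -/
theorem lintegral_strip_enorm_sq {c : ℝ} {G : ℂ → ℂ} (hG : DifferentiableOn ℂ G (strip (-c) c))
    (hd : GaussianDecay c G) {a b : ℝ} (hab : a ≤ b) (ha : -c ≤ a) (hb : b ≤ c) :
    ∫⁻ w in strip a b, ‖G w‖ₑ ^ 2
      = ∫⁻ ξ, ‖𝓕 (line G 0) ξ‖ₑ ^ 2 * ENNReal.ofReal (stripWeight a b ξ) := by
  rcases hab.eq_or_lt with rfl | hlt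
  · simp [strip, stripWeight]
  have hsub : strip a b ⊆ strip (-c) c := preimage_mono (Ioo_subset_Ioo ha hb)
  have h0 : |(0 : ℝ)| < c := by simp; linarith
  have hcF := continuous_fourier_line hG hd h0
  have hm : AEMeasurable (fun w => ‖G w‖ₑ ^ 2) (volume.restrict (strip a b)) :=
    ((hG.mono hsub).continuousOn.aemeasurable (isOpen_strip a b).measurableSet).enorm.pow_const 2
  rw [setLIntegral_strip hm]
  have h1 : ∀ y ∈ Ioo a b, ∫⁻ x : ℝ, ‖G (x + y * Complex.I)‖ₑ ^ 2
      = ∫⁻ ξ, ‖𝓕 (line G 0) ξ‖ₑ ^ 2 * ENNReal.ofReal (Real.exp (-(4 * Real.pi * ξ * y))) :=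
    fun y hy => lintegral_line_sq hG hd (abs_lt.2 ⟨ha.trans_lt hy.1, hy.2.trans_le hb⟩)
  rw [setLIntegral_congr_fun measurableSet_Ioo h1, lintegral_lintegral_swap]
  · congr 1
    ext ξ
    rw [lintegral_const_mul _ (by fun_prop), ofReal_stripWeight hab]
  · apply Measurable.aemeasurable
    have := hcF.measurable
    fun_prop

/-! ### The weights of strips -/

theorem continuous_stripWeight (a b : ℝ) : Continuous (stripWeight a b) :=
  intervalIntegral.continuous_parametric_intervalIntegral_of_continuous' (by fun_prop) a b

theorem stripWeight_nonneg {a b : ℝ} (hab : a ≤ b) (ξ : ℝ) : 0 ≤ stripWeight a b ξ :=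
  intervalIntegral.integral_nonneg hab fun _ _ => (Real.exp_pos _).le

theorem stripWeight_pos {a b : ℝ} (hab : a < b) (ξ : ℝ) : 0 < stripWeight a b ξ :=
  intervalIntegral.intervalIntegral_pos_of_pos (Continuous.intervalIntegrable (by fun_prop) _ _)
    (fun _ => Real.exp_pos _) hab

theorem stripWeight_add (a b d ξ : ℝ) :
    stripWeight a b ξ + stripWeight b d ξ = stripWeight a d ξ :=
  intervalIntegral.integral_add_adjacent_intervals
    (Continuous.intervalIntegrable (by fun_prop) _ _)
    (Continuous.intervalIntegrable (by fun_prop) _ _)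

theorem stripWeight_mono {p a b q : ℝ} (hpa : p ≤ a) (hbq : b ≤ q) (ξ : ℝ) :
    stripWeight a b ξ ≤ stripWeight p q ξ := by
  rw [← stripWeight_add p a q, ← stripWeight_add a b q]
  linarith [stripWeight_nonneg hpa ξ, stripWeight_nonneg hbq ξ]

theorem stripWeight_neg (a b ξ : ℝ) : stripWeight a b (-ξ) = stripWeight (-b) (-a) ξ := by
  rw [stripWeight, stripWeight, ← intervalIntegral.integral_comp_neg]
  simp

theorem stripWeight_le {a b ξ : ℝ} (hab : a ≤ b) (hξ : 0 ≤ ξ) :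
    stripWeight a b ξ ≤ (b - a) * Real.exp (-(4 * Real.pi * ξ * a)) := by
  have : stripWeight a b ξ ≤ ∫ _ in a..b, Real.exp (-(4 * Real.pi * ξ * a)) := by
    refine intervalIntegral.integral_mono_on hab (Continuous.intervalIntegrable (by fun_prop) _ _)
      (by simp) fun y hy => ?_
    have := hy.1
    gcongr
  simpa using this

theorem le_stripWeight {a b ξ : ℝ} (hab : a ≤ b) (hξ : 0 ≤ ξ) :
    (b - a) * Real.exp (-(4 * Real.pi * ξ * b)) ≤ stripWeight a b ξ := by
  have : ∫ _ in a..b, Real.exp (-(4 * Real.pi * ξ * b)) ≤ stripWeight a b ξ := by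
    refine intervalIntegral.integral_mono_on hab (by simp)
      (Continuous.intervalIntegrable (by fun_prop) _ _) fun y hy => ?_
    have := hy.2
    gcongr
  simpa using this

theorem stripWeight_symm_le {c : ℝ} (hc : 0 ≤ c) (ξ : ℝ) :
    stripWeight (-c) c ξ ≤ 2 * c * Real.exp (4 * Real.pi * c * |ξ|) := by
  have key : ∀ η : ℝ, 0 ≤ η →
      stripWeight (-c) c η ≤ 2 * c * Real.exp (4 * Real.pi * c * η) := fun η hη =>
    (stripWeight_le (by linarith) hη).trans (le_of_eq (by ring_nf))
  rcases le_total 0 ξ with h | h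
  · rw [abs_of_nonneg h]
    exact key ξ h
  · rw [abs_of_nonpos h]
    simpa [stripWeight_neg] using key (-ξ) (by linarith)

/-- As `ξ → +∞` the weights concentrate at the lower edge of the large strip, so a substrip that
stays away from that edge has vanishing relative weight. -/
theorem tendsto_stripWeight_div_atTop {p a b q : ℝ} (hpa : p < a) (hab : a ≤ b) (hbq : b ≤ q) :
    Tendsto (fun ξ => stripWeight a b ξ / stripWeight p q ξ) atTop (𝓝 0) := by
  set m := (p + a) / 2 with hm
  have hpm : p < m := by rw [hm]; linarith
  have hma : m < a := by rw [hm]; linarith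
  have hlim : Tendsto (fun ξ : ℝ => (b - a) / (m - p) * Real.exp (-(4 * Real.pi * (a - m) * ξ)))
      atTop (𝓝 0) := by
    have h1 : 0 < 4 * Real.pi * (a - m) := by
      have := Real.pi_pos
      have : 0 < a - m := by linarith
      positivity
    have := (Real.tendsto_exp_atBot.comp (tendsto_neg_atTop_atBot.comp
      (tendsto_id.const_mul_atTop h1))).const_mul ((b - a) / (m - p))
    simpa using this
  refine tendsto_of_tendsto_of_tendsto_of_le_of_le' tendsto_const_nhds hlim
    (Eventually.of_forall fun ξ => div_nonneg (stripWeight_nonneg hab ξ)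
      (stripWeight_nonneg (by linarith) ξ)) ?_
  filter_upwards [eventually_ge_atTop 0] with ξ hξ
  have h1 : (m - p) * Real.exp (-(4 * Real.pi * ξ * m)) ≤ stripWeight p q ξ :=
    (le_stripWeight hpm.le hξ).trans (stripWeight_mono le_rfl (by linarith) ξ)
  have h2 : 0 < m - p := by linarith
  calc stripWeight a b ξ / stripWeight p q ξ
      ≤ ((b - a) * Real.exp (-(4 * Real.pi * ξ * a)))
        / ((m - p) * Real.exp (-(4 * Real.pi * ξ * m))) := by
        have h3 := stripWeight_le hab hξ
        have h4 : 0 ≤ b - a := by linarith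
        gcongr
    _ = (b - a) / (m - p) * Real.exp (-(4 * Real.pi * (a - m) * ξ)) := by
        rw [mul_div_mul_comm, ← Real.exp_sub]
        congr 2
        ring

theorem tendsto_stripWeight_div_atBot {p a b q : ℝ} (hpa : p ≤ a) (hab : a ≤ b) (hbq : b < q) :
    Tendsto (fun ξ => stripWeight a b ξ / stripWeight p q ξ) atBot (𝓝 0) := by
  have := (tendsto_stripWeight_div_atTop (p := -q) (a := -b) (b := -a) (q := -p) (by linarith)
    (by linarith) (by linarith)).comp tendsto_neg_atBot_atTop
  refine this.congr fun ξ => ?_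
  simp [← stripWeight_neg]

theorem tendsto_stripWeight_div_atBot_one {p a q : ℝ} (hpa : p ≤ a) (haq : a < q) :
    Tendsto (fun ξ => stripWeight a q ξ / stripWeight p q ξ) atBot (𝓝 1) := by
  have := (tendsto_stripWeight_div_atBot le_rfl hpa haq).const_sub 1
  rw [sub_zero] at this
  refine this.congr fun ξ => ?_
  rw [eq_div_iff (stripWeight_pos (by linarith) ξ).ne', sub_mul,
    div_mul_cancel₀ _ (stripWeight_pos (by linarith) ξ).ne', ← stripWeight_add p a q]
  ring

/-! ### Operators that are multiplication operators in a spectral representation -/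

theorem integrable_gaussian_mul_exp (k : ℝ) :
    Integrable fun t : ℝ => Real.exp (-(2 * Real.pi * t ^ 2)) * Real.exp (k * |t|) := by
  have hb : (0 : ℝ) < 1 := one_pos
  refine ((integrable_exp_neg_mul_sq hb).const_mul (Real.exp (k ^ 2 / 4))).mono' (by fun_prop)
    (Eventually.of_forall fun t => ?_)
  rw [Real.norm_of_nonneg (by positivity), ← Real.exp_add, ← Real.exp_add, Real.exp_le_exp]
  nlinarith [Real.pi_gt_three, sq_abs t, sq_nonneg (|t| - k / 2), sq_nonneg t]

section Spectral

variable {H K : Type*} [NormedAddCommGroup H] [InnerProductSpace ℂ H]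
  [NormedAddCommGroup K] [InnerProductSpace ℂ K]

/-- A densely defined isometric representation `f ↦ φ` of `H` in `L²(s dξ)` (given as the relation
`Rel f φ`) which carries the form `‖R f‖²` to `∫ |φ|² u`; thus `R* R` becomes multiplication by
`u / s`. The representation need not be known to be onto; its range is only asked to contain, up to
phases, the Gaussians of all centres and widths. -/
structure IsSpectralRep (R : H →L[ℂ] K) (s u : ℝ → ℝ) (Rel : H → (ℝ → ℂ) → Prop) : Prop where
  continuous : ∀ {f φ}, Rel f φ → Continuous φ
  integrable : ∀ {f φ}, Rel f φ → Integrable fun ξ => ‖φ ξ‖ ^ 2 * s ξ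
  norm_sq : ∀ {f φ}, Rel f φ → ∫ ξ, ‖φ ξ‖ ^ 2 * s ξ = ‖f‖ ^ 2
  norm_map_sq : ∀ {f φ}, Rel f φ → ∫ ξ, ‖φ ξ‖ ^ 2 * u ξ = ‖R f‖ ^ 2
  add : ∀ {f g φ γ}, Rel f φ → Rel g γ → Rel (f + g) (φ + γ)
  sub : ∀ {f g φ γ}, Rel f φ → Rel g γ → Rel (f - g) (φ - γ)
  dense : Dense {f | ∃ φ, Rel f φ}
  gaussian : ∀ ξ₀ σ : ℝ, 0 < σ →
    ∃ f φ, Rel f φ ∧ ∀ ξ, ‖φ ξ‖ ^ 2 = Real.exp (-(2 * Real.pi * ((ξ - ξ₀) / σ) ^ 2))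
  continuous_s : Continuous s
  continuous_u : Continuous u
  pos_s : ∀ ξ, 0 < s ξ
  nonneg_u : ∀ ξ, 0 ≤ u ξ
  le_s : ∀ ξ, u ξ ≤ s ξ

variable {R : H →L[ℂ] K} {s u : ℝ → ℝ} {Rel : H → (ℝ → ℂ) → Prop}

namespace IsSpectralRep

theorem integrable_mul (h : IsSpectralRep R s u Rel) {f : H} {φ : ℝ → ℂ} (hf : Rel f φ)
    {F : ℝ → ℝ} {C : ℝ} (hF : Continuous F) (hC : ∀ ξ, |F ξ| ≤ C * s ξ) :
    Integrable fun ξ => ‖φ ξ‖ ^ 2 * F ξ := by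
  have := h.continuous hf
  refine ((h.integrable hf).const_mul C).mono' (by fun_prop) (Eventually.of_forall fun ξ => ?_)
  rw [norm_mul, Real.norm_of_nonneg (by positivity), Real.norm_eq_abs, mul_left_comm]
  gcongr
  exact hC ξ

theorem continuous_div (h : IsSpectralRep R s u Rel) : Continuous fun ξ => u ξ / s ξ :=
  h.continuous_u.div h.continuous_s fun ξ => (h.pos_s ξ).ne'

theorem abs_sub_mul_le (h : IsSpectralRep R s u Rel) (l ξ : ℝ) :
    |u ξ - l * s ξ| ≤ (1 + |l|) * s ξ := by
  have h1 := h.pos_s ξ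
  calc |u ξ - l * s ξ| ≤ |u ξ| + |l * s ξ| := abs_sub _ _
    _ = u ξ + |l| * s ξ := by rw [abs_of_nonneg (h.nonneg_u ξ), abs_mul, abs_of_pos h1]
    _ ≤ (1 + |l|) * s ξ := by linarith [h.le_s ξ]

theorem abs_sq_div_le (h : IsSpectralRep R s u Rel) (l ξ : ℝ) :
    |(u ξ - l * s ξ) ^ 2 / s ξ| ≤ (1 + |l|) ^ 2 * s ξ := by
  have h1 := h.pos_s ξ
  rw [abs_of_nonneg (by positivity), div_le_iff₀ h1, ← sq_abs]
  calc |u ξ - l * s ξ| ^ 2 ≤ ((1 + |l|) * s ξ) ^ 2 := by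
        gcongr
        exact h.abs_sub_mul_le l ξ
    _ = _ := by ring

/-- The quadratic form of `R* R - l` in the representation. -/
theorem norm_map_sq_sub (h : IsSpectralRep R s u Rel) {f : H} {φ : ℝ → ℂ} (hf : Rel f φ) (l : ℝ) :
    ‖R f‖ ^ 2 - l * ‖f‖ ^ 2 = ∫ ξ, ‖φ ξ‖ ^ 2 * (u ξ - l * s ξ) := by
  rw [← h.norm_map_sq hf, ← h.norm_sq hf, ← integral_const_mul, ← integral_sub]
  · congr 1
    ext ξ
    ring
  · exact h.integrable_mul hf h.continuous_u (C := 1) fun ξ => by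
      rw [abs_of_nonneg (h.nonneg_u ξ), one_mul]
      exact h.le_s ξ
  · exact (h.integrable hf).const_mul l

variable [CompleteSpace H] [CompleteSpace K]

/-- In the representation, `R* R` acts as multiplication by `u / s`, up to an orthogonal
projection. -/
theorem norm_sub_sq_le (h : IsSpectralRep R s u Rel) {f : H} {φ : ℝ → ℂ} (hf : Rel f φ) (l : ℝ) :
    ‖(ContinuousLinearMap.adjoint R).comp R f - (l : ℂ) • f‖ ^ 2
      ≤ ∫ ξ, ‖φ ξ‖ ^ 2 * ((u ξ - l * s ξ) ^ 2 / s ξ) := by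
  -- Polarization bounds `⟪k, g⟫` for all `g` in the represented dense subspace; by density, the
  -- bound may be used for `g = k`.
  set k := (ContinuousLinearMap.adjoint R).comp R f - (l : ℂ) • f with hk
  set E := ∫ ξ, ‖φ ξ‖ ^ 2 * ((u ξ - l * s ξ) ^ 2 / s ξ) with hE
  have hcs := h.continuous_s
  have hcu := h.continuous_u
  have hpol : ∀ g : H, 4 * (inner ℂ k g).re
      = (‖R (f + g)‖ ^ 2 - l * ‖f + g‖ ^ 2) - (‖R (f - g)‖ ^ 2 - l * ‖f - g‖ ^ 2) := by
    intro g
    have h1 : (inner ℂ k g).re = (inner ℂ (R f) (R g)).re - l * (inner ℂ f g).re := by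
      rw [hk, inner_sub_left, ContinuousLinearMap.comp_apply,
        ContinuousLinearMap.adjoint_inner_left, inner_smul_left]
      simp
    have h2 := norm_add_sq (𝕜 := ℂ) (R f) (R g)
    have h3 := norm_sub_sq (𝕜 := ℂ) (R f) (R g)
    have h4 := norm_add_sq (𝕜 := ℂ) f g
    have h5 := norm_sub_sq (𝕜 := ℂ) f g
    simp only [RCLike.re_to_complex] at h2 h3 h4 h5
    rw [map_add, map_sub, h1, h2, h3, h4, h5]
    ring
  have hdom : ∀ g ∈ {f | ∃ φ, Rel f φ}, 4 * (inner ℂ k g).re ≤ 2 * E + 2 * ‖g‖ ^ 2 := by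
    rintro g ⟨γ, hg⟩
    have hI : ∀ {f φ}, Rel f φ → Integrable fun ξ => ‖φ ξ‖ ^ 2 * (u ξ - l * s ξ) := fun hf =>
      h.integrable_mul hf (by fun_prop) (h.abs_sub_mul_le l)
    have hI2 : Integrable fun ξ => ‖φ ξ‖ ^ 2 * ((u ξ - l * s ξ) ^ 2 / s ξ) :=
      h.integrable_mul hf (by
        have := fun ξ => (h.pos_s ξ).ne'
        fun_prop (disch := assumption)) (h.abs_sq_div_le l)
    rw [hpol, h.norm_map_sq_sub (h.add hf hg), h.norm_map_sq_sub (h.sub hf hg),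
      ← integral_sub (hI (h.add hf hg)) (hI (h.sub hf hg)), hE, ← h.norm_sq hg,
      ← integral_const_mul, ← integral_const_mul,
      ← integral_add (hI2.const_mul 2) ((h.integrable hg).const_mul 2)]
    refine integral_mono ((hI (h.add hf hg)).sub (hI (h.sub hf hg)))
      ((hI2.const_mul 2).add ((h.integrable hg).const_mul 2)) fun ξ => ?_
    have hs := h.pos_s ξ
    set d := u ξ - l * s ξ with hd
    have h4 := norm_add_sq (𝕜 := ℂ) (φ ξ) (γ ξ)
    have h5 := norm_sub_sq (𝕜 := ℂ) (φ ξ) (γ ξ)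
    have h6 : |RCLike.re (inner ℂ (φ ξ) (γ ξ))| ≤ ‖φ ξ‖ * ‖γ ξ‖ :=
      (RCLike.abs_re_le_norm _).trans (norm_inner_le_norm _ _)
    simp only [Pi.add_apply, Pi.sub_apply]
    rw [← sub_mul, h4, h5]
    have h7 : RCLike.re (inner ℂ (φ ξ) (γ ξ)) * d ≤ ‖φ ξ‖ * ‖γ ξ‖ * |d| :=
      (le_abs_self _).trans (by rw [abs_mul]; gcongr)
    have h8 : 2 * (‖φ ξ‖ * ‖γ ξ‖ * |d|) ≤ ‖φ ξ‖ ^ 2 * (d ^ 2 / s ξ) + ‖γ ξ‖ ^ 2 * s ξ := by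
      have : ‖φ ξ‖ ^ 2 * (d ^ 2 / s ξ) + ‖γ ξ‖ ^ 2 * s ξ - 2 * (‖φ ξ‖ * ‖γ ξ‖ * |d|)
          = (‖φ ξ‖ * |d| - ‖γ ξ‖ * s ξ) ^ 2 / s ξ := by
        rw [← sq_abs d]
        field_simp
        ring
      have h9 : 0 ≤ (‖φ ξ‖ * |d| - ‖γ ξ‖ * s ξ) ^ 2 / s ξ := by positivity
      linarith
    linarith
  have hall : 4 * (inner ℂ k k).re ≤ 2 * E + 2 * ‖k‖ ^ 2 := by
    have hcl : IsClosed {g : H | 4 * (inner ℂ k g).re ≤ 2 * E + 2 * ‖g‖ ^ 2} :=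
      isClosed_le (by fun_prop) (by fun_prop)
    exact hcl.closure_subset_iff.2 hdom (h.dense k)
  have hkk : (inner ℂ k k).re = ‖k‖ ^ 2 := by
    rw [inner_self_eq_norm_sq_to_K]
    norm_cast
  rw [hkk] at hall
  linarith

theorem norm_adjoint_comp_self_le (h : IsSpectralRep R s u Rel) {M : ℝ} (hM0 : 0 ≤ M)
    (hM : ∀ ξ, u ξ ≤ M * s ξ) : ‖(ContinuousLinearMap.adjoint R).comp R‖ ≤ M := by
  rw [ContinuousLinearMap.norm_adjoint_comp_self]
  have key : ∀ f, ‖R f‖ ^ 2 ≤ M * ‖f‖ ^ 2 := by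
    intro f
    have hcl : IsClosed {g : H | ‖R g‖ ^ 2 ≤ M * ‖g‖ ^ 2} :=
      isClosed_le (by fun_prop) (by fun_prop)
    refine hcl.closure_subset_iff.2 ?_ (h.dense f)
    rintro g ⟨γ, hg⟩
    rw [mem_ofPred_eq, ← h.norm_map_sq hg, ← h.norm_sq hg, ← integral_const_mul]
    refine integral_mono (h.integrable_mul hg h.continuous_u (C := 1) fun ξ => by
      rw [abs_of_nonneg (h.nonneg_u ξ), one_mul]
      exact h.le_s ξ) ((h.integrable hg).const_mul M) fun ξ => ?_
    have := mul_le_mul_of_nonneg_left (hM ξ) (sq_nonneg ‖γ ξ‖)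
    simp only
    linarith
  have : ‖R‖ ≤ Real.sqrt M := by
    refine R.opNorm_le_bound (Real.sqrt_nonneg M) fun f => ?_
    refine le_of_sq_le_sq ?_ (by positivity)
    rw [mul_pow, Real.sq_sqrt hM0]
    exact key f
  nlinarith [Real.sq_sqrt hM0, norm_nonneg R]

/-- The values of the symbol `u / s` belong to the spectrum: Gaussians concentrating at a
frequency are approximate eigenvectors. -/
theorem div_mem_spectrum (h : IsSpectralRep R s u Rel) {C k : ℝ}
    (hs : ∀ ξ, s ξ ≤ C * Real.exp (k * |ξ|)) (hk : 0 ≤ k) (ξ₀ : ℝ) :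
    ((u ξ₀ / s ξ₀ : ℝ) : ℂ) ∈ spectrum ℂ ((ContinuousLinearMap.adjoint R).comp R) := by
  set l := u ξ₀ / s ξ₀ with hl
  set T := (ContinuousLinearMap.adjoint R).comp R with hT
  intro hun
  have hcs := h.continuous_s
  have hcu := h.continuous_u
  have hsne := fun ξ => (h.pos_s ξ).ne'
  obtain ⟨c, hc, hbelow⟩ : ∃ c > 0, ∀ f : H, c * ‖f‖ ^ 2 ≤ ‖T f - (l : ℂ) • f‖ ^ 2 := by
    obtain ⟨S, hS⟩ := hun
    set B : H →L[ℂ] H := ↑S⁻¹ with hB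
    have hinv : ∀ f, B ((l : ℂ) • f - T f) = f := fun f => by
      have : B * (algebraMap ℂ (H →L[ℂ] H) l - T) = 1 := by rw [← hS, hB, Units.inv_mul]
      have := congrArg (fun A : H →L[ℂ] H => A f) this
      simpa [Algebra.algebraMap_eq_smul_one] using this
    refine ⟨((‖B‖ + 1) ^ 2)⁻¹, by positivity, fun f => ?_⟩
    rw [inv_mul_le_iff₀ (by positivity), ← mul_pow, norm_sub_rev]
    gcongr
    calc ‖f‖ = ‖B ((l : ℂ) • f - T f)‖ := by rw [hinv]
      _ ≤ ‖B‖ * ‖(l : ℂ) • f - T f‖ := B.le_opNorm _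
      _ ≤ _ := by gcongr; linarith
  -- As `T - l` is bounded below by `√c`, `norm_sub_sq_le` makes `F` have nonpositive mean against
  -- Gaussians centred at `ξ₀`, however narrow; but `F ξ₀ > 0`.
  set F : ℝ → ℝ := fun ξ => c * s ξ - (u ξ - l * s ξ) ^ 2 / s ξ with hF
  have hFc : Continuous F := by fun_prop (disch := assumption)
  have hF0 : 0 < F ξ₀ := by
    have : u ξ₀ - l * s ξ₀ = 0 := by rw [hl, div_mul_cancel₀ _ (hsne ξ₀), sub_self]
    simp only [hF, this]
    have := h.pos_s ξ₀
    simp only [ne_eq, OfNat.ofNat_ne_zero, not_false_eq_true, zero_pow, zero_div, sub_zero]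
    positivity
  have hFle : ∀ ξ, |F ξ| ≤ (c + (1 + |l|) ^ 2) * s ξ := fun ξ => by
    refine (abs_sub _ _).trans ?_
    rw [abs_of_pos (mul_pos hc (h.pos_s ξ)), add_mul]
    gcongr
    exact h.abs_sq_div_le l ξ
  have hneg : ∀ σ : ℝ, 0 < σ →
      ∫ t, Real.exp (-(2 * Real.pi * t ^ 2)) * F (ξ₀ + σ * t) ≤ 0 := by
    intro σ hσ
    obtain ⟨f, φ, hf, hφ⟩ := h.gaussian ξ₀ σ hσ
    have h1 := (hbelow f).trans (h.norm_sub_sq_le hf l)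
    have h2 : ∫ ξ, ‖φ ξ‖ ^ 2 * F ξ ≤ 0 := by
      rw [← h.norm_sq hf, ← integral_const_mul, ← sub_nonpos, ← integral_sub
        ((h.integrable hf).const_mul c) (h.integrable_mul hf (by fun_prop (disch := assumption))
          (h.abs_sq_div_le l))] at h1
      refine le_trans (le_of_eq ?_) h1
      congr 1
      ext ξ
      simp only [hF]
      ring
    have h3 : ∫ t, Real.exp (-(2 * Real.pi * t ^ 2)) * F (ξ₀ + σ * t)
        = |σ⁻¹| * ∫ ξ, ‖φ ξ‖ ^ 2 * F ξ := by
      have e1 := Measure.integral_comp_mul_left (fun t => ‖φ (ξ₀ + t)‖ ^ 2 * F (ξ₀ + t)) σ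
      rw [integral_add_left_eq_self (fun t => ‖φ t‖ ^ 2 * F t) ξ₀, smul_eq_mul] at e1
      rw [← e1]
      congr 1
      ext t
      rw [hφ]
      congr 3
      field_simp
      ring
    rw [h3]
    exact mul_nonpos_of_nonneg_of_nonpos (abs_nonneg _) h2
  have hlim : Tendsto (fun σ : ℝ => ∫ t, Real.exp (-(2 * Real.pi * t ^ 2)) * F (ξ₀ + σ * t))
      (𝓝[>] 0) (𝓝 (∫ t, Real.exp (-(2 * Real.pi * t ^ 2)) * F (ξ₀ + 0 * t))) := by
    have hC0 : 0 ≤ C := by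
      have := (h.pos_s 0).le.trans (hs 0)
      simpa using this
    refine tendsto_integral_filter_of_dominated_convergence
      (fun t => (c + (1 + |l|) ^ 2) * C * Real.exp (k * |ξ₀|)
        * (Real.exp (-(2 * Real.pi * t ^ 2)) * Real.exp (k * |t|)))
      (Eventually.of_forall fun σ => by fun_prop) ?_
      ((integrable_gaussian_mul_exp k).const_mul _) (Eventually.of_forall fun t => ?_)
    · filter_upwards [Ioo_mem_nhdsGT (one_pos : (0 : ℝ) < 1)] with σ hσ
      refine Eventually.of_forall fun t => ?_
      rw [norm_mul, Real.norm_of_nonneg (Real.exp_pos _).le, Real.norm_eq_abs, mul_left_comm]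
      gcongr
      have h4 : |ξ₀ + σ * t| ≤ |ξ₀| + |t| := by
        refine (abs_add_le _ _).trans ?_
        rw [abs_mul, abs_of_pos hσ.1]
        nlinarith [abs_nonneg t, hσ.2]
      calc |F (ξ₀ + σ * t)| ≤ (c + (1 + |l|) ^ 2) * s (ξ₀ + σ * t) := hFle _
        _ ≤ (c + (1 + |l|) ^ 2) * (C * Real.exp (k * |ξ₀ + σ * t|)) := by
          gcongr
          exact hs _
        _ ≤ (c + (1 + |l|) ^ 2) * (C * Real.exp (k * (|ξ₀| + |t|))) := by gcongr
        _ = _ := by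
          rw [mul_add, Real.exp_add]
          ring
    · refine Tendsto.const_mul _ ?_
      refine (Continuous.tendsto (f := fun σ : ℝ => F (ξ₀ + σ * t)) (by fun_prop) 0).mono_left
        nhdsWithin_le_nhds
  have hle := le_of_tendsto hlim (eventually_mem_nhdsWithin.mono fun σ hσ => hneg σ hσ)
  simp only [zero_mul, add_zero] at hle
  rw [integral_mul_const] at hle
  have hpos : 0 < ∫ t : ℝ, Real.exp (-(2 * Real.pi * t ^ 2)) := by
    have := integral_gaussian (2 * Real.pi)
    simp only [neg_mul] at this
    rw [this]
    have := Real.pi_pos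
    positivity
  exact absurd hle (not_le.2 (mul_pos hpos hF0))

end IsSpectralRep

end Spectral

/-! ### The spectrum in terms of the symbol -/

section

variable {H K : Type*} [NormedAddCommGroup H] [InnerProductSpace ℂ H] [CompleteSpace H]
  [NormedAddCommGroup K] [InnerProductSpace ℂ K] [CompleteSpace K]

open scoped ComplexOrder in
theorem spectrum_adjoint_comp_self_subset (R : H →L[ℂ] K) :
    spectrum ℂ ((ContinuousLinearMap.adjoint R).comp R)
      ⊆ Complex.ofReal '' Icc 0 ‖(ContinuousLinearMap.adjoint R).comp R‖ := by
  intro z hz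
  have hpos : 0 ≤ (ContinuousLinearMap.adjoint R).comp R :=
    (ContinuousLinearMap.nonneg_iff_isPositive _).2
      (ContinuousLinearMap.isPositive_adjoint_comp_self R)
  have hz0 : 0 ≤ z := spectrum_nonneg_of_nonneg hpos hz
  have hre : ((z.re : ℝ) : ℂ) = z := (Complex.eq_re_of_ofReal_le (r := 0) (by simpa using hz0)).symm
  refine ⟨z.re, ⟨(Complex.nonneg_iff.1 hz0).1, ?_⟩, hre⟩
  cases subsingleton_or_nontrivial H with
  | inl hH =>
    rw [spectrum.of_subsingleton] at hz
    exact hz.elim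
  | inr hH => exact (Complex.re_le_norm z).trans (spectrum.norm_le_norm_of_mem hz)

variable {R : H →L[ℂ] K} {s u : ℝ → ℝ} {Rel : H → (ℝ → ℂ) → Prop}

namespace IsSpectralRep

/-- If every value between `0` and `M` is taken by the symbol, the spectrum contains `[0, M]`. -/
theorem image_Icc_subset_spectrum (h : IsSpectralRep R s u Rel) {C k : ℝ}
    (hs : ∀ ξ, s ξ ≤ C * Real.exp (k * |ξ|)) (hk : 0 ≤ k) {M : ℝ} (hM : 0 < M)
    (hsurj : ∀ l ∈ Ioo 0 M, ∃ ξ, u ξ / s ξ = l) :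
    Complex.ofReal '' Icc 0 M ⊆ spectrum ℂ ((ContinuousLinearMap.adjoint R).comp R) := by
  rw [image_subset_iff, ← closure_Ioo hM.ne]
  refine ((spectrum.isClosed _).preimage Complex.continuous_ofReal).closure_subset_iff.2 ?_
  intro l hl
  obtain ⟨ξ, rfl⟩ := hsurj l hl
  exact h.div_mem_spectrum hs hk ξ

theorem spectrum_eq_of_tendsto_zero_one (h : IsSpectralRep R s u Rel) {C k : ℝ}
    (hs : ∀ ξ, s ξ ≤ C * Real.exp (k * |ξ|)) (hk : 0 ≤ k)
    (h0 : Tendsto (fun ξ => u ξ / s ξ) atTop (𝓝 0))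
    (h1 : Tendsto (fun ξ => u ξ / s ξ) atBot (𝓝 1)) :
    spectrum ℂ ((ContinuousLinearMap.adjoint R).comp R) = Complex.ofReal '' Icc 0 1 := by
  refine Subset.antisymm ((spectrum_adjoint_comp_self_subset R).trans (image_mono ?_))
    (h.image_Icc_subset_spectrum hs hk one_pos fun l hl => ?_)
  · refine Icc_subset_Icc_right (h.norm_adjoint_comp_self_le zero_le_one fun ξ => ?_)
    rw [one_mul]
    exact h.le_s ξ
  · obtain ⟨a, ha⟩ := (h0.eventually_lt_const hl.1).exists
    obtain ⟨b, hb⟩ := (h1.eventually_const_lt hl.2).exists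
    exact mem_range_of_exists_le_of_exists_ge h.continuous_div ⟨a, ha.le⟩ ⟨b, hb.le⟩

/-- For a symbol vanishing at both ends, the norm is the maximum of the symbol. -/
theorem spectrum_eq_of_tendsto_zero_zero (h : IsSpectralRep R s u Rel) {C k : ℝ}
    (hs : ∀ ξ, s ξ ≤ C * Real.exp (k * |ξ|)) (hk : 0 ≤ k)
    (hpos : ∀ ξ, 0 < u ξ) (hlt : ∀ ξ, u ξ < s ξ)
    (h0 : Tendsto (fun ξ => u ξ / s ξ) atTop (𝓝 0))
    (h1 : Tendsto (fun ξ => u ξ / s ξ) atBot (𝓝 0)) :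
    spectrum ℂ ((ContinuousLinearMap.adjoint R).comp R)
        = Complex.ofReal '' Icc 0 ‖(ContinuousLinearMap.adjoint R).comp R‖ ∧
      0 < ‖(ContinuousLinearMap.adjoint R).comp R‖ ∧
      ‖(ContinuousLinearMap.adjoint R).comp R‖ < 1 := by
  have hm0 : ∀ ξ, 0 < u ξ / s ξ := fun ξ => div_pos (hpos ξ) (h.pos_s ξ)
  obtain ⟨η, hη⟩ : ∃ η, ∀ ξ, u ξ / s ξ ≤ u η / s η := by
    refine h.continuous_div.exists_forall_ge' 0 ?_
    rw [cocompact_eq_atBot_atTop]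
    exact eventually_sup.2 ⟨h1.eventually_le_const (hm0 0), h0.eventually_le_const (hm0 0)⟩
  have hle : ‖(ContinuousLinearMap.adjoint R).comp R‖ ≤ u η / s η :=
    h.norm_adjoint_comp_self_le (hm0 η).le fun ξ => (div_le_iff₀ (h.pos_s ξ)).1 (hη ξ)
  have hge : u η / s η ≤ ‖(ContinuousLinearMap.adjoint R).comp R‖ := by
    obtain ⟨l, hl, e⟩ := spectrum_adjoint_comp_self_subset R (h.div_mem_spectrum hs hk η)
    rw [← Complex.ofReal_inj.1 e]
    exact hl.2
  have heq := le_antisymm hle hge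
  refine ⟨Subset.antisymm (spectrum_adjoint_comp_self_subset R) ?_, ?_, ?_⟩
  · rw [heq]
    refine h.image_Icc_subset_spectrum hs hk (hm0 η) fun l hl => ?_
    obtain ⟨a, ha⟩ := (h0.eventually_lt_const hl.1).exists
    exact mem_range_of_exists_le_of_exists_ge h.continuous_div ⟨a, ha.le⟩ ⟨η, hl.2.le⟩
  · rw [heq]
    exact hm0 η
  · rw [heq]
    exact (div_lt_one (h.pos_s η)).2 (hlt η)

end IsSpectralRep

end

/-! ### Conformal coordinates adapted to a geodesic -/

/-- A pair of mutually inverse conformal maps `Φ : V → W` and `Ψ : W → V`. -/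
structure IsConformalPair (Φ Ψ : ℂ → ℂ) (V W : Set ℂ) : Prop where
  mapsTo : MapsTo Φ V W
  mapsTo_inv : MapsTo Ψ W V
  differentiableOn : DifferentiableOn ℂ Φ V
  differentiableOn_inv : DifferentiableOn ℂ Ψ W
  leftInvOn : ∀ w ∈ V, Ψ (Φ w) = w
  rightInvOn : ∀ z ∈ W, Φ (Ψ z) = z

/-- The function on the disc which is the hyperbolic sine of the signed distance from the geodesic
`2 Re (z c̄) = A (1 + |z|²)`, where `|c|² = 1 + A²`. (In the hyperboloid model it is the Lorentz
product with the unit normal vector `(A, c)` of the geodesic.) -/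
noncomputable def sinhDist (A : ℝ) (c z : ℂ) : ℝ :=
  (2 * (z * conj c).re - A * (1 + ‖z‖ ^ 2)) / (1 - ‖z‖ ^ 2)

/-- The Möbius transformation from the disc to the right half plane which takes the geodesic with
unit normal vector `(A, c)` to the positive real axis. -/
noncomputable def toHalfPlane (A : ℝ) (c z : ℂ) : ℂ :=
  Complex.I * ((A + Complex.I) - z * conj c) / ((A + Complex.I) * (z * conj c - (A - Complex.I)))

/-- The inverse of `toHalfPlane`. -/
noncomputable def ofHalfPlane (A : ℝ) (c E : ℂ) : ℂ :=
  (A + Complex.I) * (Complex.I + (A - Complex.I) * E)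
    / (conj c * (Complex.I + (A + Complex.I) * E))

section

variable {A : ℝ} {c : ℂ}

theorem mem_disc {z : ℂ} : z ∈ (disc : Set ℂ) ↔ ‖z‖ < 1 := by
  change z ∈ Metric.ball 0 1 ↔ _
  simp

theorem one_sub_norm_sq_pos {z : ℂ} (hz : z ∈ (disc : Set ℂ)) : 0 < 1 - ‖z‖ ^ 2 := by
  rw [mem_disc] at hz
  nlinarith [norm_nonneg z]

theorem ofReal_add_I_ne_zero (A : ℝ) : (A + Complex.I : ℂ) ≠ 0 := fun h => by
  simpa using congrArg Complex.im h

theorem conj_ne_zero_of (hc : ‖c‖ ^ 2 = 1 + A ^ 2) : conj c ≠ 0 := by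
  have : c ≠ 0 := by
    rintro rfl
    simp at hc
    nlinarith
  simpa using this

theorem denom_ne_zero (hc : ‖c‖ ^ 2 = 1 + A ^ 2) {z : ℂ} (hz : z ∈ (disc : Set ℂ)) :
    z * conj c - (A - Complex.I) ≠ 0 := by
  intro h
  have h1 : ‖z * conj c‖ ^ 2 = 1 + A ^ 2 := by
    rw [sub_eq_zero.1 h, ← Complex.normSq_eq_norm_sq]
    simp [Complex.normSq_apply]
    ring
  rw [norm_mul, RCLike.norm_conj, mul_pow, hc] at h1
  have := one_sub_norm_sq_pos hz
  nlinarith [sq_nonneg A]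

theorem normSq_ofReal_add_I (A : ℝ) : Complex.normSq (A + Complex.I) = 1 + A ^ 2 := by
  simp [Complex.normSq_apply]
  ring

theorem norm_ofReal_add_I (hc : ‖c‖ ^ 2 = 1 + A ^ 2) : ‖(A + Complex.I : ℂ)‖ = ‖c‖ := by
  rw [← sq_eq_sq₀ (norm_nonneg _) (norm_nonneg _), hc, ← Complex.normSq_eq_norm_sq,
    normSq_ofReal_add_I]

theorem norm_pos_of (hc : ‖c‖ ^ 2 = 1 + A ^ 2) : 0 < ‖c‖ := by
  have := conj_ne_zero_of hc
  rw [norm_pos_iff]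
  simpa using this

theorem norm_sq_eq (z : ℂ) : ‖z‖ ^ 2 = z.re ^ 2 + z.im ^ 2 := by
  rw [← Complex.normSq_eq_norm_sq, Complex.normSq_apply]
  ring

/-- Real and imaginary part of the half plane coordinate; their quotient is `sinhDist`. -/
theorem toHalfPlane_re_im (hc : ‖c‖ ^ 2 = 1 + A ^ 2) {z : ℂ} (hz : z ∈ (disc : Set ℂ)) :
    (toHalfPlane A c z).re = (1 - ‖z‖ ^ 2) / Complex.normSq (z * conj c - (A - Complex.I)) ∧
    (toHalfPlane A c z).im = (2 * (z * conj c).re - A * (1 + ‖z‖ ^ 2))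
      / Complex.normSq (z * conj c - (A - Complex.I)) := by
  have hd := denom_ne_zero hc hz
  have hA : (1 + A ^ 2 : ℝ) ≠ 0 := by positivity
  have hN : Complex.normSq (z * conj c - (A - Complex.I)) ≠ 0 := by simpa using hd
  have hv : (z * conj c).re ^ 2 + (z * conj c).im ^ 2 = (1 + A ^ 2) * ‖z‖ ^ 2 := by
    rw [← norm_sq_eq, norm_mul, RCLike.norm_conj, mul_pow, hc, mul_comm]
  rw [toHalfPlane]
  generalize z * conj c = v at *
  generalize ‖z‖ ^ 2 = q at *
  have hM : Complex.normSq ((A + Complex.I) * (v - (A - Complex.I)))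
      = (1 + A ^ 2) * Complex.normSq (v - (A - Complex.I)) := by
    rw [map_mul, normSq_ofReal_add_I]
  constructor
  · rw [Complex.div_re, hM, ← add_div, div_eq_div_iff (mul_ne_zero hA hN) hN, ← mul_assoc]
    congr 1
    simp
    linear_combination (-1 : ℝ) * hv
  · rw [Complex.div_im, hM, ← sub_div, div_eq_div_iff (mul_ne_zero hA hN) hN, ← mul_assoc]
    congr 1
    simp
    linear_combination (-A : ℝ) * hv

theorem toHalfPlane_re_pos (hc : ‖c‖ ^ 2 = 1 + A ^ 2) {z : ℂ} (hz : z ∈ (disc : Set ℂ)) :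
    0 < (toHalfPlane A c z).re := by
  rw [(toHalfPlane_re_im hc hz).1]
  exact div_pos (one_sub_norm_sq_pos hz) (Complex.normSq_pos.2 (denom_ne_zero hc hz))

theorem sinhDist_eq (hc : ‖c‖ ^ 2 = 1 + A ^ 2) {z : ℂ} (hz : z ∈ (disc : Set ℂ)) :
    sinhDist A c z = (toHalfPlane A c z).im / (toHalfPlane A c z).re := by
  have hN : Complex.normSq (z * conj c - (A - Complex.I)) ≠ 0 := by
    simpa using denom_ne_zero hc hz
  rw [(toHalfPlane_re_im hc hz).1, (toHalfPlane_re_im hc hz).2, div_div_div_cancel_right₀ hN,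
    sinhDist]

theorem halfPlane_denom_ne_zero (A : ℝ) {E : ℂ} (hE : 0 < E.re) :
    Complex.I + (A + Complex.I) * E ≠ 0 := by
  intro h
  have h1 := congrArg Complex.re h
  have h2 := congrArg Complex.im h
  simp at h1 h2
  have h3 : E.im = A * E.re := by linarith
  rw [h3] at h2
  nlinarith [mul_nonneg (sq_nonneg A) hE.le]

theorem ofHalfPlane_toHalfPlane (hc : ‖c‖ ^ 2 = 1 + A ^ 2) {z : ℂ} (hz : z ∈ (disc : Set ℂ)) :
    ofHalfPlane A c (toHalfPlane A c z) = z := by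
  have hd := denom_ne_zero hc hz
  have hζ := ofReal_add_I_ne_zero A
  have hc0 := conj_ne_zero_of hc
  have h2 := halfPlane_denom_ne_zero A (toHalfPlane_re_pos hc hz)
  rw [ofHalfPlane, div_eq_iff (mul_ne_zero hc0 h2), toHalfPlane]
  generalize conj c = d at *
  field_simp
  ring_nf

theorem toHalfPlane_ofHalfPlane (hc : ‖c‖ ^ 2 = 1 + A ^ 2) {E : ℂ} (hE : 0 < E.re) :
    toHalfPlane A c (ofHalfPlane A c E) = E := by
  have hζ := ofReal_add_I_ne_zero A
  have hc0 := conj_ne_zero_of hc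
  have h2 := halfPlane_denom_ne_zero A hE
  have hv : ofHalfPlane A c E * conj c
      = (A + Complex.I) * (Complex.I + (A - Complex.I) * E)
        / (Complex.I + (A + Complex.I) * E) := by
    rw [ofHalfPlane]
    field_simp
  rw [toHalfPlane, hv]
  have h3 : (A + Complex.I) * (Complex.I + (A - Complex.I) * E) / (Complex.I + (A + Complex.I) * E)
      - (A - Complex.I) = -2 / (Complex.I + (A + Complex.I) * E) := by
    rw [div_sub' h2]
    congr 1
    linear_combination (2 : ℂ) * Complex.I_sq
  have h4 : (A + Complex.I) - (A + Complex.I) * (Complex.I + (A - Complex.I) * E)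
      / (Complex.I + (A + Complex.I) * E)
      = (A + Complex.I) * (2 * Complex.I * E) / (Complex.I + (A + Complex.I) * E) := by
    rw [sub_div' h2]
    congr 1
    ring
  rw [h3, h4]
  field_simp
  linear_combination (-E : ℂ) * Complex.I_sq

theorem ofHalfPlane_mem_disc (hc : ‖c‖ ^ 2 = 1 + A ^ 2) {E : ℂ} (hE : 0 < E.re) :
    ofHalfPlane A c E ∈ (disc : Set ℂ) := by
  have h2 := halfPlane_denom_ne_zero A hE
  rw [mem_disc, ofHalfPlane, norm_div, norm_mul, norm_mul, RCLike.norm_conj]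
  have hc0 := norm_pos_of hc
  rw [norm_ofReal_add_I hc, mul_div_mul_left _ _ hc0.ne', div_lt_one (norm_pos_iff.2 h2),
    ← sq_lt_sq₀ (norm_nonneg _) (norm_nonneg _), norm_sq_eq, norm_sq_eq]
  simp
  nlinarith

/-- Conformal invariance of `sinh² (d / 2)`: the left side expresses it for points of the disc, the
right side for the image points in the half plane. -/
theorem norm_sub_sq_div_eq (hc : ‖c‖ ^ 2 = 1 + A ^ 2) {z w : ℂ} (hz : z ∈ (disc : Set ℂ))
    (hw : w ∈ (disc : Set ℂ)) : ‖z - w‖ ^ 2 / ((1 - ‖z‖ ^ 2) * (1 - ‖w‖ ^ 2))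
      = ‖toHalfPlane A c z - toHalfPlane A c w‖ ^ 2
        / (4 * ((toHalfPlane A c z).re * (toHalfPlane A c w).re)) := by
  have hdz := denom_ne_zero hc hz
  have hdw := denom_ne_zero hc hw
  have hζ := ofReal_add_I_ne_zero A
  have h1 : toHalfPlane A c z - toHalfPlane A c w = 2 * ((z - w) * conj c)
      / ((A + Complex.I) * (z * conj c - (A - Complex.I)) * (w * conj c - (A - Complex.I))) := by
    rw [toHalfPlane, toHalfPlane, div_sub_div _ _ (mul_ne_zero hζ hdz) (mul_ne_zero hζ hdw),
      div_eq_div_iff (by positivity) (by positivity)]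
    linear_combination (2 * ((w - z) * conj c) * (A + Complex.I) ^ 2
      * (z * conj c - (A - Complex.I)) * (w * conj c - (A - Complex.I))) * Complex.I_sq
  have hz1 := one_sub_norm_sq_pos hz
  have hw1 := one_sub_norm_sq_pos hw
  have hz2 := norm_pos_iff.2 hdz
  have hw2 := norm_pos_iff.2 hdw
  have hc0 := norm_pos_of hc
  rw [h1, (toHalfPlane_re_im hc hz).1, (toHalfPlane_re_im hc hw).1, Complex.normSq_eq_norm_sq,
    Complex.normSq_eq_norm_sq, norm_div, norm_mul, norm_mul, norm_mul, norm_mul,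
    norm_ofReal_add_I hc,
    RCLike.norm_conj, RCLike.norm_ofNat]
  field_simp
  ring

end

/-- The conformal map from the disc to the strip `|Im w| < π / 2` which takes the geodesic with
unit normal vector `(A, c)` to the real axis. -/
noncomputable def toStrip (A : ℝ) (c z : ℂ) : ℂ := Complex.log (toHalfPlane A c z)

/-- The inverse of `toStrip`. -/
noncomputable def ofStrip (A : ℝ) (c w : ℂ) : ℂ := ofHalfPlane A c (Complex.exp w)

section

variable {A : ℝ} {c : ℂ}

theorem exp_re_pos {w : ℂ} (hw : w ∈ strip (-(Real.pi / 2)) (Real.pi / 2)) :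
    0 < (Complex.exp w).re := by
  rw [Complex.exp_re]
  exact mul_pos (Real.exp_pos _) (Real.cos_pos_of_mem_Ioo hw)

theorem differentiableOn_toHalfPlane (hc : ‖c‖ ^ 2 = 1 + A ^ 2) :
    DifferentiableOn ℂ (toHalfPlane A c) (disc : Set ℂ) := by
  unfold toHalfPlane
  refine DifferentiableOn.div (by fun_prop) (by fun_prop) fun z hz => ?_
  exact mul_ne_zero (ofReal_add_I_ne_zero A) (denom_ne_zero hc hz)

theorem isConformalPair_strip (hc : ‖c‖ ^ 2 = 1 + A ^ 2) :
    IsConformalPair (ofStrip A c) (toStrip A c) (strip (-(Real.pi / 2)) (Real.pi / 2))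
      (disc : Set ℂ) where
  mapsTo w hw := ofHalfPlane_mem_disc hc (exp_re_pos hw)
  mapsTo_inv z hz := by
    rw [mem_strip_symm, toStrip, Complex.log_im, Complex.abs_arg_lt_pi_div_two_iff]
    exact Or.inl (toHalfPlane_re_pos hc hz)
  differentiableOn := by
    unfold ofStrip ofHalfPlane
    refine DifferentiableOn.div (by fun_prop) (by fun_prop) fun w hw => ?_
    exact mul_ne_zero (conj_ne_zero_of hc) (halfPlane_denom_ne_zero A (exp_re_pos hw))
  differentiableOn_inv := (differentiableOn_toHalfPlane hc).clog fun z hz =>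
    Or.inl (toHalfPlane_re_pos hc hz)
  leftInvOn w hw := by
    rw [toStrip, ofStrip, toHalfPlane_ofHalfPlane hc (exp_re_pos hw)]
    have := abs_lt.1 (mem_strip_symm.1 hw)
    exact Complex.log_exp (by linarith [Real.pi_pos]) (by linarith [Real.pi_pos])
  rightInvOn z hz := by
    have h := toHalfPlane_re_pos hc hz
    rw [toStrip, ofStrip, Complex.exp_log, ofHalfPlane_toHalfPlane hc hz]
    intro h0
    simp [h0] at h

theorem arctan_sinhDist (hc : ‖c‖ ^ 2 = 1 + A ^ 2) {z : ℂ} (hz : z ∈ (disc : Set ℂ)) :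
    Real.arctan (sinhDist A c z) = (toStrip A c z).im := by
  have h := (isConformalPair_strip hc).mapsTo_inv hz
  rw [toStrip] at h ⊢
  rw [sinhDist_eq hc hz, ← Complex.tan_arg, ← Complex.log_im]
  exact Real.arctan_tan h.1 h.2

/-! ### Distances from geodesics -/

theorem two_mul_arsinh {x : ℝ} (hx : 0 ≤ x) :
    2 * Real.arsinh x = Real.arsinh (Real.sqrt (4 * x ^ 2 * (1 + x ^ 2))) := by
  rw [← Real.arsinh_sinh (2 * Real.arsinh x), Real.sinh_two_mul, Real.sinh_arsinh,
    Real.cosh_arsinh, Real.sqrt_mul (by positivity), show 4 * x ^ 2 = (2 * x) ^ 2 by ring,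
    Real.sqrt_sq (by positivity)]

/-- The distance to a point of the geodesic, in half plane coordinates `E` and `r > 0`. -/
theorem hypDist_eq (hc : ‖c‖ ^ 2 = 1 + A ^ 2) {z w : ℂ} (hz : z ∈ (disc : Set ℂ))
    (hw : w ∈ (disc : Set ℂ)) {E : ℂ} (hE : toHalfPlane A c z = E) {r : ℝ}
    (hr : toHalfPlane A c w = r) :
    hypDist z w = Real.arsinh (Real.sqrt (((‖E‖ ^ 2 + r ^ 2) ^ 2 - 4 * r ^ 2 * E.re ^ 2)
      / (4 * r ^ 2 * E.re ^ 2))) := by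
  have hz1 := one_sub_norm_sq_pos hz
  have hw1 := one_sub_norm_sq_pos hw
  have hE0 := toHalfPlane_re_pos hc hz
  have hr0 := toHalfPlane_re_pos hc hw
  have h := norm_sub_sq_div_eq hc hz hw
  rw [hE] at hE0
  rw [hr, Complex.ofReal_re] at hr0
  rw [hE, hr, Complex.ofReal_re] at h
  have hx : (‖z - w‖ / Real.sqrt ((1 - ‖z‖ ^ 2) * (1 - ‖w‖ ^ 2))) ^ 2
      = ‖E - r‖ ^ 2 / (4 * (E.re * r)) := by
    rw [div_pow, Real.sq_sqrt (by positivity), h]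
  rw [hypDist, two_mul_arsinh (by positivity), hx]
  congr 2
  have h2 : ‖E - r‖ ^ 2 = ‖E‖ ^ 2 + r ^ 2 - 2 * r * E.re := by
    rw [norm_sq_eq, norm_sq_eq]
    simp
    ring
  rw [h2]
  field_simp
  ring

/-- The distance from the geodesic is attained at the point with the same modulus in the half plane
coordinate, by the inequality `2 |E| r ≤ |E|² + r²`. -/
theorem hypInfDist_eq (hc : ‖c‖ ^ 2 = 1 + A ^ 2) {z : ℂ} (hz : z ∈ (disc : Set ℂ)) :
    hypInfDist z {w | w ∈ disc ∧ sinhDist A c w = 0} = Real.arsinh |sinhDist A c z| := by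
  set E := toHalfPlane A c z with hE
  have hE0 : 0 < E.re := toHalfPlane_re_pos hc hz
  have hsq : |sinhDist A c z| = Real.sqrt (E.im ^ 2 / E.re ^ 2) := by
    rw [sinhDist_eq hc hz, ← div_pow, Real.sqrt_sq_eq_abs]
  have hnE := norm_sq_eq E
  have hn0 : 0 < ‖E‖ := norm_pos_iff.2 fun h => by simp [h] at hE0
  refine IsLeast.csInf_eq ⟨⟨ofHalfPlane A c (‖E‖ : ℝ), ?_, ?_⟩, ?_⟩
  · have hpos : 0 < ((‖E‖ : ℝ) : ℂ).re := by simpa using hn0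
    have hmem := ofHalfPlane_mem_disc hc hpos
    refine ⟨hmem, ?_⟩
    rw [sinhDist_eq hc hmem, toHalfPlane_ofHalfPlane hc hpos]
    simp
  · have hpos : 0 < ((‖E‖ : ℝ) : ℂ).re := by simpa using hn0
    have hmem := ofHalfPlane_mem_disc hc hpos
    simp only
    rw [hypDist_eq hc hz hmem hE.symm (toHalfPlane_ofHalfPlane hc hpos), hsq]
    congr 2
    rw [show (‖E‖ ^ 2 + ‖E‖ ^ 2) ^ 2 - 4 * ‖E‖ ^ 2 * E.re ^ 2 = 4 * ‖E‖ ^ 2 * E.im ^ 2 by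
      rw [hnE]; ring]
    field_simp
  · rintro _ ⟨w, ⟨hw, hw0⟩, rfl⟩
    have hr0 := toHalfPlane_re_pos hc hw
    have him : (toHalfPlane A c w).im = 0 := by
      rw [sinhDist_eq hc hw, div_eq_zero_iff] at hw0
      exact hw0.resolve_right hr0.ne'
    set r := (toHalfPlane A c w).re with hr
    have hwr : toHalfPlane A c w = r := by
      apply Complex.ext <;> simp [hr, him]
    simp only
    rw [hypDist_eq hc hz hw hE.symm hwr, hsq, Real.arsinh_le_arsinh]
    apply Real.sqrt_le_sqrt
    rw [div_le_div_iff₀ (by positivity) (by positivity)]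
    have h1 : 4 * r ^ 2 * E.im ^ 2 ≤ (‖E‖ ^ 2 + r ^ 2) ^ 2 - 4 * r ^ 2 * E.re ^ 2 := by
      have : E.im ^ 2 = ‖E‖ ^ 2 - E.re ^ 2 := by linarith
      rw [this]
      nlinarith [sq_nonneg (‖E‖ ^ 2 - r ^ 2)]
    nlinarith [mul_le_mul_of_nonneg_right h1 (sq_nonneg E.re)]

theorem sinhDist_neg (A : ℝ) (c z : ℂ) : sinhDist (-A) (-c) z = -sinhDist A c z := by
  simp only [sinhDist, map_neg, mul_neg, Complex.neg_re]
  ring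

end

/-- Every geodesic is the zero set of `sinhDist A c` for some unit normal vector `(A, c)`. -/
theorem IsGeodesic.exists_sinhDist {Γ : Set ℂ} (h : IsGeodesic Γ) :
    ∃ (A : ℝ) (c : ℂ), ‖c‖ ^ 2 = 1 + A ^ 2 ∧ Γ = {z | z ∈ disc ∧ sinhDist A c z = 0} := by
  have key : ∀ {A : ℝ} {c z : ℂ}, z ∈ (disc : Set ℂ) →
      (sinhDist A c z = 0 ↔ 2 * (z * conj c).re - A * (1 + ‖z‖ ^ 2) = 0) := fun hz => by
    rw [sinhDist, div_eq_zero_iff, or_iff_left (one_sub_norm_sq_pos hz).ne']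
  -- The circle with centre `c` and radius `r` has normal vector `(1, c) / r`; the line spanned by
  -- `v` has the normal vector `(0, i v / |v|)`.
  rcases h with ⟨c, r, hr, hc, rfl⟩ | ⟨v, hv, rfl⟩
  · refine ⟨r⁻¹, (r⁻¹ : ℝ) * c, ?_, ?_⟩
    · rw [norm_mul, mul_pow, Complex.norm_real, Real.norm_eq_abs, sq_abs, hc]
      field_simp
      ring
    · ext z
      refine and_congr_right fun hz => ?_
      rw [key hz, ← sq_eq_sq₀ (norm_nonneg _) hr.le]
      have h1 : ‖z - c‖ ^ 2 = ‖z‖ ^ 2 + 1 + r ^ 2 - 2 * (z * conj c).re := by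
        have : ‖z - c‖ ^ 2 = ‖z‖ ^ 2 + ‖c‖ ^ 2 - 2 * (z * conj c).re := by
          rw [norm_sq_eq, norm_sq_eq, norm_sq_eq]
          simp
          ring
        rw [this, hc]
        ring
      have h2 : (z * conj ((r⁻¹ : ℝ) * c)).re = r⁻¹ * (z * conj c).re := by
        rw [map_mul, Complex.conj_ofReal, mul_left_comm, Complex.re_ofReal_mul]
      rw [h1, h2, show 2 * (r⁻¹ * (z * conj c).re) - r⁻¹ * (1 + ‖z‖ ^ 2)
        = r⁻¹ * (2 * (z * conj c).re - (1 + ‖z‖ ^ 2)) by ring, mul_eq_zero,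
        or_iff_right (inv_ne_zero hr.ne')]
      constructor <;> intro h <;> linarith
  · have hv' : 0 < ‖v‖ := norm_pos_iff.2 hv
    refine ⟨0, Complex.I * v / ‖v‖, ?_, ?_⟩
    · simp [hv'.ne']
    · ext z
      refine and_congr_right fun hz => ?_
      rw [key hz]
      have h1 : (z * conj (Complex.I * v / ‖v‖)).re = (z.im * v.re - z.re * v.im) / ‖v‖ := by
        rw [map_div₀, Complex.conj_ofReal, ← mul_div_assoc, Complex.div_ofReal_re]
        simp
      rw [h1, zero_mul, sub_zero, mul_eq_zero, or_iff_right two_ne_zero, div_eq_zero_iff,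
        or_iff_left hv'.ne']
      constructor
      · rintro ⟨t, rfl⟩
        simp
        ring
      · intro h
        have hn : v.re ^ 2 + v.im ^ 2 ≠ 0 := by
          rw [← norm_sq_eq]
          positivity
        refine ⟨(z.re * v.re + z.im * v.im) / (v.re ^ 2 + v.im ^ 2), ?_⟩
        apply Complex.ext
        · rw [Complex.re_ofReal_mul, div_mul_eq_mul_div, eq_div_iff hn]
          linear_combination v.im * (-1 : ℝ) * h
        · rw [Complex.im_ofReal_mul, div_mul_eq_mul_div, eq_div_iff hn]
          linear_combination v.re * h

section

variable {A : ℝ} {c : ℂ}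

theorem continuousOn_sinhDist (A : ℝ) (c : ℂ) : ContinuousOn (sinhDist A c) (disc : Set ℂ) := by
  unfold sinhDist
  exact ContinuousOn.div (by fun_prop) (by fun_prop) fun z hz => (one_sub_norm_sq_pos hz).ne'

theorem isPreconnected_sinhDist_pos (hc : ‖c‖ ^ 2 = 1 + A ^ 2) :
    IsPreconnected {z | z ∈ disc ∧ 0 < sinhDist A c z} := by
  have hp := isConformalPair_strip hc
  have hsub : strip 0 (Real.pi / 2) ⊆ strip (-(Real.pi / 2)) (Real.pi / 2) :=
    preimage_mono (Ioo_subset_Ioo_left (by linarith [Real.pi_pos]))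
  have himg : {z | z ∈ disc ∧ 0 < sinhDist A c z} = ofStrip A c '' strip 0 (Real.pi / 2) := by
    ext z
    constructor
    · rintro ⟨hz, hz0⟩
      refine ⟨toStrip A c z, ⟨?_, (hp.mapsTo_inv hz).2⟩, hp.rightInvOn z hz⟩
      rw [← arctan_sinhDist hc hz]
      exact Real.arctan_pos.2 hz0
    · rintro ⟨w, hw, rfl⟩
      refine ⟨hp.mapsTo (hsub hw), Real.arctan_pos.1 ?_⟩
      rw [arctan_sinhDist hc (hp.mapsTo (hsub hw)), hp.leftInvOn w (hsub hw)]
      exact hw.1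
  rw [himg]
  refine IsPreconnected.image ?_ _ (hp.differentiableOn.continuousOn.mono hsub)
  exact ((convex_Ioo 0 (Real.pi / 2)).linear_preimage Complex.imLm).isPreconnected

/-- The side of the geodesic which contains a point with positive `sinhDist`. It is connected as the
conformal image of a convex substrip. -/
theorem connectedComponentIn_eq_of_pos (hc : ‖c‖ ^ 2 = 1 + A ^ 2) {w : ℂ}
    (hw : w ∈ (disc : Set ℂ)) (hw0 : 0 < sinhDist A c w) :
    connectedComponentIn ((disc : Set ℂ) \ {z | z ∈ disc ∧ sinhDist A c z = 0}) w
      = {z | z ∈ disc ∧ 0 < sinhDist A c z} := by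
  set X := (disc : Set ℂ) \ {z | z ∈ disc ∧ sinhDist A c z = 0} with hX
  have hwX : w ∈ X := ⟨hw, fun h => hw0.ne' h.2⟩
  refine Subset.antisymm (fun z hz => ?_)
    ((isPreconnected_sinhDist_pos hc).subset_connectedComponentIn ⟨hw, hw0⟩ fun z hz => ⟨hz.1, fun h => hz.2.ne' h.2⟩)
  have hzX := connectedComponentIn_subset X w hz
  refine ⟨hzX.1, ?_⟩
  by_contra! hneg
  have himg := (isPreconnected_connectedComponentIn (F := X) (x := w)).image (sinhDist A c)
    ((continuousOn_sinhDist A c).mono ((connectedComponentIn_subset X w).trans sdiff_subset))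
  obtain ⟨y, hy, hy0⟩ := himg.ordConnected.out ⟨z, hz, rfl⟩
    ⟨w, mem_connectedComponentIn hwX, rfl⟩ ⟨hneg, hw0.le⟩
  have := connectedComponentIn_subset X w hy
  exact this.2 ⟨this.1, hy0⟩

end

/-- The signed distance from a geodesic has the form `arsinh (sinhDist A c z)`. -/
theorem exists_signedDist_eq {Γ S : Set ℂ} (hΓ : IsGeodesic Γ) (hS : IsSide Γ S) :
    ∃ (A : ℝ) (c : ℂ), ‖c‖ ^ 2 = 1 + A ^ 2 ∧
      ∀ z ∈ (disc : Set ℂ), signedDist Γ S z = Real.arsinh (sinhDist A c z) := by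
  obtain ⟨A, c, hc, rfl⟩ := hΓ.exists_sinhDist
  obtain ⟨w, hw, rfl⟩ := hS
  -- After a change of sign of the normal vector, the chosen side is the positive one.
  obtain ⟨A, c, hc, hΓ, hw0⟩ : ∃ (A' : ℝ) (c' : ℂ), ‖c'‖ ^ 2 = 1 + A' ^ 2 ∧
      {z | z ∈ disc ∧ sinhDist A c z = 0} = {z | z ∈ disc ∧ sinhDist A' c' z = 0} ∧
      0 < sinhDist A' c' w := by
    have hne : sinhDist A c w ≠ 0 := fun h => hw.2 ⟨hw.1, h⟩
    rcases hne.lt_or_gt with h | h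
    · exact ⟨-A, -c, by simpa using hc, by simp [sinhDist_neg], by simpa [sinhDist_neg] using h⟩
    · exact ⟨A, c, hc, rfl, h⟩
  refine ⟨A, c, hc, fun z hz => ?_⟩
  rw [hΓ, connectedComponentIn_eq_of_pos hc hw.1 hw0, signedDist, hypInfDist_eq hc hz]
  split_ifs with h
  · rw [abs_of_pos h.2]
  · have : sinhDist A c z ≤ 0 := not_lt.1 fun h0 => h ⟨hz, h0⟩
    rw [abs_of_nonpos this, Real.arsinh_neg, neg_neg]

theorem lt_signedDist_iff {A : ℝ} {c : ℂ} (hc : ‖c‖ ^ 2 = 1 + A ^ 2) {z : ℂ}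
    (hz : z ∈ (disc : Set ℂ)) (t : ℝ) : t < Real.arsinh (sinhDist A c z) ↔
      Real.arctan (Real.sinh t) < (toStrip A c z).im := by
  rw [← arctan_sinhDist hc hz, Real.arctan_strictMono.lt_iff_lt, ← Real.sinh_lt_sinh,
    Real.sinh_arsinh]

theorem signedDist_lt_iff {A : ℝ} {c : ℂ} (hc : ‖c‖ ^ 2 = 1 + A ^ 2) {z : ℂ}
    (hz : z ∈ (disc : Set ℂ)) (t : ℝ) : Real.arsinh (sinhDist A c z) < t ↔
      (toStrip A c z).im < Real.arctan (Real.sinh t) := by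
  rw [← arctan_sinhDist hc hz, Real.arctan_strictMono.lt_iff_lt, ← Real.sinh_lt_sinh,
    Real.sinh_arsinh]

/-- A conformal map takes the disc to the strip `|Im w| < π / 2` and the crescent to a substrip
with the same upper edge. -/
theorem IsHypercyclicCrescent.exists_conformalPair {U : Set ℂ} (h : IsHypercyclicCrescent U) :
    ∃ (Φ Ψ : ℂ → ℂ) (a : ℝ),
      IsConformalPair Φ Ψ (strip (-(Real.pi / 2)) (Real.pi / 2)) (disc : Set ℂ) ∧
      -(Real.pi / 2) < a ∧ a < Real.pi / 2 ∧
      U = (disc : Set ℂ) ∩ Ψ ⁻¹' strip a (Real.pi / 2) := by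
  obtain ⟨Γ, S, t, hΓ, hS, rfl⟩ := h
  obtain ⟨A, c, hc, hd⟩ := exists_signedDist_eq hΓ hS
  refine ⟨ofStrip A c, toStrip A c, Real.arctan (Real.sinh t), isConformalPair_strip hc,
    Real.neg_pi_div_two_lt_arctan _, Real.arctan_lt_pi_div_two _, ?_⟩
  ext z
  refine and_congr_right fun hz => ?_
  rw [hd z hz, lt_signedDist_iff hc hz]
  exact ⟨fun h => ⟨h, ((isConformalPair_strip hc).mapsTo_inv hz).2⟩, fun h => h.1⟩

/-- A conformal map takes the disc to the strip `|Im w| < π / 2` and the lune to a substrip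
with edges in its interior. -/
theorem IsHypercyclicLune.exists_conformalPair {U : Set ℂ} (h : IsHypercyclicLune U) :
    ∃ (Φ Ψ : ℂ → ℂ) (a b : ℝ),
      IsConformalPair Φ Ψ (strip (-(Real.pi / 2)) (Real.pi / 2)) (disc : Set ℂ) ∧
      -(Real.pi / 2) < a ∧ a < b ∧ b < Real.pi / 2 ∧
      U = (disc : Set ℂ) ∩ Ψ ⁻¹' strip a b := by
  obtain ⟨Γ, S, s, t, hΓ, hS, hst, rfl⟩ := h
  obtain ⟨A, c, hc, hd⟩ := exists_signedDist_eq hΓ hS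
  refine ⟨ofStrip A c, toStrip A c, Real.arctan (Real.sinh s), Real.arctan (Real.sinh t),
    isConformalPair_strip hc, Real.neg_pi_div_two_lt_arctan _,
    Real.arctan_strictMono (Real.sinh_strictMono hst), Real.arctan_lt_pi_div_two _, ?_⟩
  ext z
  refine and_congr_right fun hz => ?_
  rw [hd z hz, lt_signedDist_iff hc hz, signedDist_lt_iff hc hz]
  rfl

/-! ### Conformal transport of Bergman functions -/

theorem enorm_sq_A2 {Ω : TopologicalSpace.Opens ℂ} (f : A2 Ω) :
    ‖f‖ₑ ^ 2 = ∫⁻ z in (Ω : Set ℂ), ‖(f : ℂ → ℂ) z‖ₑ ^ 2 := by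
  have h2 := eLpNorm_nnreal_pow_eq_lintegral (μ := (volume : Measure ℂ).restrict (Ω : Set ℂ))
    (f := (f : ℂ → ℂ)) (p := 2) (by norm_num)
  have h3 : ‖f‖ₑ = ‖f.1‖ₑ := by rw [← ofReal_norm, ← ofReal_norm, Submodule.coe_norm]
  rw [h3, Lp.enorm_def]
  simpa using h2

theorem restrictionOp_ae {Ω U : TopologicalSpace.Opens ℂ} (h : U ≤ Ω) (f : A2 Ω) :
    (restrictionOp h f : ℂ → ℂ) =ᵐ[volume.restrict (U : Set ℂ)] (f : ℂ → ℂ) :=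
  MemLp.coeFn_toLp ((Lp.memLp f.1).mono_measure (Measure.restrict_mono h le_rfl))

namespace IsConformalPair

variable {Φ Ψ : ℂ → ℂ} {V W : Set ℂ}

theorem deriv_mul_deriv (h : IsConformalPair Φ Ψ V W) (hV : IsOpen V) (hW : IsOpen W) {z : ℂ}
    (hz : z ∈ W) : deriv Φ (Ψ z) * deriv Ψ z = 1 := by
  have h1 := (h.differentiableOn.differentiableAt (hV.mem_nhds (h.mapsTo_inv hz))).hasDerivAt
  have h2 := (h.differentiableOn_inv.differentiableAt (hW.mem_nhds hz)).hasDerivAt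
  refine (h1.comp z h2).unique ((hasDerivAt_id z).congr_of_eventuallyEq ?_)
  filter_upwards [hW.mem_nhds hz] with w hw using h.rightInvOn w hw

theorem image_inter_preimage (h : IsConformalPair Φ Ψ V W) {X : Set ℂ} (hX : X ⊆ V) :
    Ψ '' (W ∩ Ψ ⁻¹' X) = X := by
  ext w
  constructor
  · rintro ⟨z, hz, rfl⟩
    exact hz.2
  · intro hw
    have := h.leftInvOn w (hX hw)
    exact ⟨Φ w, ⟨h.mapsTo (hX hw), by rwa [mem_preimage, this]⟩, this⟩

/-- Conformal change of variables for square integrals. -/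
theorem lintegral_comp_mul_deriv (h : IsConformalPair Φ Ψ V W) (hW : IsOpen W) {X : Set ℂ}
    (hXV : X ⊆ V) (hX : IsOpen X) (G : ℂ → ℂ) :
    ∫⁻ z in W ∩ Ψ ⁻¹' X, ‖G (Ψ z) * deriv Ψ z‖ₑ ^ 2 = ∫⁻ w in X, ‖G w‖ₑ ^ 2 := by
  have ho : IsOpen (W ∩ Ψ ⁻¹' X) :=
    h.differentiableOn_inv.continuousOn.isOpen_inter_preimage hW hX
  have hd : ∀ z ∈ W ∩ Ψ ⁻¹' X, HasFDerivWithinAt Ψ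
      ((fderiv ℂ Ψ z).restrictScalars ℝ) (W ∩ Ψ ⁻¹' X) z := fun z hz =>
    ((h.differentiableOn_inv.differentiableAt
      (hW.mem_nhds hz.1)).hasFDerivAt.restrictScalars ℝ).hasFDerivWithinAt
  have hinj : InjOn Ψ (W ∩ Ψ ⁻¹' X) := fun z hz w hw e => by
    rw [← h.rightInvOn z hz.1, e, h.rightInvOn w hw.1]
  have key := lintegral_image_eq_lintegral_abs_det_fderiv_mul volume ho.measurableSet hd hinj
    (fun w => ‖G w‖ₑ ^ 2)
  rw [h.image_inter_preimage hXV] at key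
  rw [key]
  congr 1
  ext z
  have hdet : |((fderiv ℂ Ψ z).restrictScalars ℝ).det| = ‖deriv Ψ z‖ ^ 2 := by
    rw [ContinuousLinearMap.det]
    change |LinearMap.det ((fderiv ℂ Ψ z : ℂ →ₗ[ℂ] ℂ).restrictScalars ℝ)| = _
    rw [LinearMap.det_restrictScalars, Algebra.norm_complex_apply,
      Complex.normSq_eq_norm_sq]
    simp
  rw [hdet, enorm_mul, mul_pow, mul_comm, ENNReal.ofReal_pow (norm_nonneg _), ofReal_norm]

end IsConformalPair

section Lift

variable {Φ Ψ : ℂ → ℂ} {V : Set ℂ} {W : TopologicalSpace.Opens ℂ}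

/-- The relation `f = (G ∘ Ψ) Ψ'` between an element `f` of the Bergman space of `W` and a
holomorphic function `G` on the conformal image `V` of `W`. -/
def IsLift (Ψ : ℂ → ℂ) (V : Set ℂ) (f : A2 W) (G : ℂ → ℂ) : Prop :=
  DifferentiableOn ℂ G V ∧
    (f : ℂ → ℂ) =ᵐ[volume.restrict (W : Set ℂ)] fun z => G (Ψ z) * deriv Ψ z

theorem IsLift.add {f g : A2 W} {F G : ℂ → ℂ} (hf : IsLift Ψ V f F) (hg : IsLift Ψ V g G) :
    IsLift Ψ V (f + g) (F + G) := by
  refine ⟨hf.1.add hg.1, ?_⟩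
  filter_upwards [hf.2, hg.2, Lp.coeFn_add (f : Lp ℂ 2 _) (g : Lp ℂ 2 _)] with z h1 h2 h3
  rw [Submodule.coe_add, h3, Pi.add_apply, h1, h2, Pi.add_apply, add_mul]

theorem IsLift.sub {f g : A2 W} {F G : ℂ → ℂ} (hf : IsLift Ψ V f F) (hg : IsLift Ψ V g G) :
    IsLift Ψ V (f - g) (F - G) := by
  refine ⟨hf.1.sub hg.1, ?_⟩
  filter_upwards [hf.2, hg.2, Lp.coeFn_sub (f : Lp ℂ 2 _) (g : Lp ℂ 2 _)] with z h1 h2 h3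
  rw [Submodule.coe_sub, h3, Pi.sub_apply, h1, h2, Pi.sub_apply, sub_mul]

theorem IsLift.enorm_sq_restrictionOp (h : IsConformalPair Φ Ψ V (W : Set ℂ)) {X : Set ℂ}
    (hXV : X ⊆ V) (hX : IsOpen X) {U : TopologicalSpace.Opens ℂ} (hU : U ≤ W)
    (hUX : (U : Set ℂ) = (W : Set ℂ) ∩ Ψ ⁻¹' X) {f : A2 W} {G : ℂ → ℂ} (hf : IsLift Ψ V f G) :
    ‖restrictionOp hU f‖ₑ ^ 2 = ∫⁻ w in X, ‖G w‖ₑ ^ 2 := by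
  rw [enorm_sq_A2, ← h.lintegral_comp_mul_deriv W.isOpen hXV hX, ← hUX]
  apply lintegral_congr_ae
  filter_upwards [restrictionOp_ae hU f, ae_mono (Measure.restrict_mono hU le_rfl) hf.2]
    with z h1 h2
  rw [h1, h2]

theorem IsLift.enorm_sq (h : IsConformalPair Φ Ψ V (W : Set ℂ)) (hV : IsOpen V)
    {f : A2 W} {G : ℂ → ℂ} (hf : IsLift Ψ V f G) : ‖f‖ₑ ^ 2 = ∫⁻ w in V, ‖G w‖ₑ ^ 2 := by
  rw [enorm_sq_A2, ← h.lintegral_comp_mul_deriv W.isOpen Subset.rfl hV,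
    inter_eq_left.2 (show (W : Set ℂ) ⊆ Ψ ⁻¹' V from h.mapsTo_inv)]
  apply lintegral_congr_ae
  filter_upwards [hf.2] with z h1
  rw [h1]

/-- Every Bergman function on `W` comes from a function on `V`, namely `(g ∘ Φ) Φ'`. -/
theorem exists_isLift (h : IsConformalPair Φ Ψ V (W : Set ℂ)) (hV : IsOpen V) (f : A2 W) :
    ∃ G, IsLift Ψ V f G := by
  obtain ⟨g, hg, hfg⟩ := f.2
  refine ⟨fun w => g (Φ w) * deriv Φ w,
    (hg.comp h.differentiableOn h.mapsTo).mul (h.differentiableOn.deriv hV), ?_⟩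
  filter_upwards [hfg, ae_restrict_mem W.isOpen.measurableSet] with z h1 hz
  rw [h1, h.rightInvOn z hz, mul_assoc, h.deriv_mul_deriv hV W.isOpen hz, mul_one]

/-- Every square integrable holomorphic function on `V` comes from a Bergman function on `W`. -/
theorem exists_of_isLift (h : IsConformalPair Φ Ψ V (W : Set ℂ)) (hV : IsOpen V) {G : ℂ → ℂ}
    (hG : DifferentiableOn ℂ G V) (hfin : ∫⁻ w in V, ‖G w‖ₑ ^ 2 < ∞) :
    ∃ f : A2 W, IsLift Ψ V f G := by
  have hd : DifferentiableOn ℂ (fun z => G (Ψ z) * deriv Ψ z) (W : Set ℂ) :=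
    (hG.comp h.differentiableOn_inv h.mapsTo_inv).mul (h.differentiableOn_inv.deriv W.isOpen)
  have hm : MemLp (fun z => G (Ψ z) * deriv Ψ z) 2 (volume.restrict (W : Set ℂ)) := by
    refine ⟨hd.continuousOn.aestronglyMeasurable W.isOpen.measurableSet, ?_⟩
    have h2 := eLpNorm_nnreal_pow_eq_lintegral (μ := (volume : Measure ℂ).restrict (W : Set ℂ))
      (f := fun z => G (Ψ z) * deriv Ψ z) (p := 2) (by norm_num)
    have h3 := h.lintegral_comp_mul_deriv W.isOpen Subset.rfl hV G
    rw [inter_eq_left.2 (show (W : Set ℂ) ⊆ Ψ ⁻¹' V from h.mapsTo_inv)] at h3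
    have h4 : eLpNorm (fun z => G (Ψ z) * deriv Ψ z) 2 (volume.restrict (W : Set ℂ)) ^ 2 < ∞ := by
      have : eLpNorm (fun z => G (Ψ z) * deriv Ψ z) 2 (volume.restrict (W : Set ℂ)) ^ 2
          = ∫⁻ z in (W : Set ℂ), ‖G (Ψ z) * deriv Ψ z‖ₑ ^ 2 := by
        simpa using h2
      rwa [this, h3]
    exact (ENNReal.pow_lt_top_iff.1 h4).resolve_right two_ne_zero
  exact ⟨⟨hm.toLp, _, hd, hm.coeFn_toLp⟩, hG, hm.coeFn_toLp⟩

end Lift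

/-! ### The spectral representation -/

theorem lintegral_strip_lt_top {c : ℝ} {G : ℂ → ℂ} {K δ : ℝ}
    (hG : DifferentiableOn ℂ G (strip (-c) c)) (hδ : 0 < δ)
    (hK : ∀ w ∈ strip (-c) c, ‖G w‖ ≤ K * Real.exp (-δ * w.re ^ 2)) :
    ∫⁻ w in strip (-c) c, ‖G w‖ₑ ^ 2 < ∞ := by
  have hm : AEMeasurable (fun w => ‖G w‖ₑ ^ 2) (volume.restrict (strip (-c) c)) :=
    (hG.continuousOn.aemeasurable (isOpen_strip _ _).measurableSet).enorm.pow_const 2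
  rw [setLIntegral_strip hm]
  have hint : Integrable fun x : ℝ => K ^ 2 * Real.exp (-(2 * δ) * x ^ 2) :=
    (integrable_exp_neg_mul_sq (by positivity)).const_mul _
  calc ∫⁻ y in Ioo (-c) c, ∫⁻ x : ℝ, ‖G (x + y * Complex.I)‖ₑ ^ 2
      ≤ ∫⁻ _ in Ioo (-c) c, ∫⁻ x : ℝ, ENNReal.ofReal (K ^ 2 * Real.exp (-(2 * δ) * x ^ 2)) := by
        refine setLIntegral_mono' measurableSet_Ioo fun y hy => lintegral_mono fun x => ?_
        rw [enorm_sq_eq_ofReal]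
        refine ENNReal.ofReal_le_ofReal ?_
        have h1 := hK (x + y * Complex.I) (mk_mem_strip (abs_lt.2 hy))
        calc ‖G (x + y * Complex.I)‖ ^ 2 ≤ (K * Real.exp (-δ * x ^ 2)) ^ 2 := by
              gcongr
              simpa using h1
          _ = K ^ 2 * Real.exp (-(2 * δ) * x ^ 2) := by
              rw [mul_pow, ← Real.exp_nat_mul]
              congr 2
              push_cast
              ring
    _ < ∞ := by
        rw [setLIntegral_const]
        refine ENNReal.mul_lt_top ?_ (by simp)
        rw [← ofReal_integral_eq_lintegral_ofReal hint
          (Eventually.of_forall fun _ => by positivity)]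
        exact ENNReal.ofReal_lt_top

/-- A Bergman function on a strip is bounded on the smaller substrips. -/
theorem exists_bound_substrip {c : ℝ} {G : ℂ → ℂ} (hG : DifferentiableOn ℂ G (strip (-c) c))
    (hfin : ∫⁻ w in strip (-c) c, ‖G w‖ₑ ^ 2 < ∞) {r : ℝ} (hr : r < c) :
    ∃ K, ∀ w : ℂ, |w.im| ≤ r → ‖G w‖ ≤ K := by
  have hρ : 0 < c - r := by linarith
  set D : ℝ := (c - r) / 2 * ((c - r) / 2) * (2 * Real.pi) with hD
  have hD0 : 0 < D := by positivity
  set N := ∫⁻ w in strip (-c) c, ‖G w‖ₑ ^ 2 with hN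
  refine ⟨Real.sqrt (N.toReal / D), fun w hw => Real.le_sqrt_of_sq_le ?_⟩
  have hsub : Metric.ball w (c - r) ⊆ strip (-c) c := fun z hz => by
    rw [mem_strip_symm]
    rw [Metric.mem_ball, dist_eq_norm] at hz
    have h1 := (Complex.abs_im_le_norm (z - w)).trans_lt hz
    rw [Complex.sub_im] at h1
    have h2 := abs_add_le (z.im - w.im) w.im
    rw [sub_add_cancel] at h2
    linarith
  have h1 := (enorm_sq_le hρ (hG.mono hsub)).trans (lintegral_mono_set hsub)
  rw [enorm_sq_eq_ofReal, ← ENNReal.ofReal_mul hD0.le, ← hN,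
    ENNReal.ofReal_le_iff_le_toReal hfin.ne] at h1
  rw [le_div_iff₀ hD0]
  linarith

theorem norm_exp_neg_mul_sq (δ : ℝ) (w : ℂ) :
    ‖Complex.exp (-(δ : ℂ) * w ^ 2)‖ = Real.exp (-δ * w.re ^ 2) * Real.exp (δ * w.im ^ 2) := by
  rw [Complex.norm_exp, ← Real.exp_add]
  congr 1
  simp [sq]
  ring

theorem norm_exp_neg_mul_sq_le {c δ : ℝ} (hδ : 0 ≤ δ) {w : ℂ} (hw : |w.im| ≤ c) :
    ‖Complex.exp (-(δ : ℂ) * w ^ 2)‖ ≤ Real.exp (δ * c ^ 2) * Real.exp (-δ * w.re ^ 2) := by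
  rw [norm_exp_neg_mul_sq, mul_comm]
  gcongr 1
  rw [Real.exp_le_exp, ← sq_abs w.im]
  gcongr

section Rep

variable {Φ Ψ : ℂ → ℂ} {W : TopologicalSpace.Opens ℂ} {c : ℝ}

/-- The Paley–Wiener representation: `φ` is the Fourier transform of the restriction to the real
axis of the strip function `G` corresponding to `f`. -/
def PaleyWienerRel (Ψ : ℂ → ℂ) (c : ℝ) (f : A2 W) (φ : ℝ → ℂ) : Prop :=
  ∃ G, IsLift Ψ (strip (-c) c) f G ∧ GaussianDecay c G ∧ φ = 𝓕 (line G 0)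

theorem fourier_line_add {F G : ℂ → ℂ} (hF : Integrable (line F 0)) (hG : Integrable (line G 0)) :
    𝓕 (line F 0) + 𝓕 (line G 0) = 𝓕 (line (F + G) 0) :=
  (VectorFourier.fourierIntegral_add Real.continuous_fourierChar
    (by exact continuous_inner (𝕜 := ℝ) (E := ℝ)) hF hG).symm

theorem fourier_line_const_mul (κ : ℂ) (G : ℂ → ℂ) :
    𝓕 (line (fun w => κ * G w) 0) = κ • 𝓕 (line G 0) :=
  VectorFourier.fourierIntegral_const_smul _ _ _ _ κ

/-- Multiplication by Gaussians gives a dense set of functions with Gaussian decay. -/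
theorem dense_paleyWienerRel (h : IsConformalPair Φ Ψ (strip (-c) c) (W : Set ℂ)) :
    Dense {f : A2 W | ∃ φ, PaleyWienerRel Ψ c f φ} := by
  have hV := isOpen_strip (-c) c
  intro f
  obtain ⟨G, hG⟩ := exists_isLift h hV f
  have hfin : ∫⁻ w in strip (-c) c, ‖G w‖ₑ ^ 2 < ∞ := by
    rw [← hG.enorm_sq h hV]
    exact ENNReal.pow_lt_top enorm_lt_top
  have hGm : AEMeasurable G (volume.restrict (strip (-c) c)) :=
    hG.1.continuousOn.aemeasurable hV.measurableSet
  set e : ℝ → ℂ → ℂ := fun δ w => Complex.exp (-(δ : ℂ) * w ^ 2) with he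
  have hed : ∀ δ, Differentiable ℂ (e δ) := fun δ => by fun_prop
  have hle : ∀ δ : ℝ, 0 ≤ δ → ∀ w ∈ strip (-c) c, ‖e δ w‖ ≤ Real.exp (δ * c ^ 2) :=
    fun δ hδ w hw => (norm_exp_neg_mul_sq_le hδ (mem_strip_symm.1 hw).le).trans
      (mul_le_of_le_one_right (Real.exp_pos _).le
        (Real.exp_le_one_iff.2 (by nlinarith [sq_nonneg w.re])))
  have hfinδ : ∀ δ : ℝ, 0 ≤ δ → ∫⁻ w in strip (-c) c, ‖e δ w * G w‖ₑ ^ 2 < ∞ := by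
    intro δ hδ
    refine lt_of_le_of_lt (setLIntegral_mono' (g := fun w =>
      ENNReal.ofReal (Real.exp (δ * c ^ 2)) ^ 2 * ‖G w‖ₑ ^ 2)
      hV.measurableSet fun w hw => ?_) ?_
    · rw [enorm_mul, mul_pow]
      gcongr
      rw [← ofReal_norm]
      exact ENNReal.ofReal_le_ofReal (hle δ hδ w hw)
    · rw [lintegral_const_mul' _ _ (by finiteness)]
      exact ENNReal.mul_lt_top (by finiteness) hfin
  have hex : ∀ δ : ℝ, 0 < δ → ∃ g : A2 W, IsLift Ψ (strip (-c) c) g fun w => e δ w * G w :=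
    fun δ hδ => exists_of_isLift h hV ((hed δ).differentiableOn.mul hG.1) (hfinδ δ hδ.le)
  have hmem : ∀ δ : ℝ, 0 < δ → ∀ g : A2 W,
      IsLift Ψ (strip (-c) c) g (fun w => e δ w * G w) → ∃ φ, PaleyWienerRel Ψ c g φ := by
    intro δ hδ g hg
    refine ⟨_, _, hg, fun r hr => ?_, rfl⟩
    obtain ⟨K, hK⟩ := exists_bound_substrip hG.1 hfin hr
    refine ⟨Real.exp (δ * r ^ 2) * K, δ, hδ, fun w hw => ?_⟩
    rw [norm_mul, mul_right_comm]
    have hK0 := (norm_nonneg _).trans (hK w hw)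
    gcongr
    · exact norm_exp_neg_mul_sq_le hδ.le hw
    · exact hK w hw
  choose! g hg using hex
  set δ : ℕ → ℝ := fun n => 1 / (n + 1) with hδ
  have hδ0 : ∀ n, 0 < δ n := fun n => Nat.one_div_pos_of_nat
  have hδ1 : ∀ n, δ n ≤ 1 := fun n => by
    rw [hδ, div_le_one (by positivity)]
    linarith [(Nat.cast_nonneg n : (0 : ℝ) ≤ n)]
  have hδlim : Tendsto δ atTop (𝓝 0) := tendsto_one_div_add_atTop_nhds_zero_nat
  have hlim : Tendsto (fun n => ∫⁻ w in strip (-c) c, ‖e (δ n) w * G w - G w‖ₑ ^ 2) atTop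
      (𝓝 0) := by
    have := tendsto_lintegral_of_dominated_convergence' (μ := volume.restrict (strip (-c) c))
      (F := fun n w => ‖e (δ n) w * G w - G w‖ₑ ^ 2) (f := fun _ => 0)
      (fun w => ENNReal.ofReal (Real.exp (c ^ 2) + 1) ^ 2 * ‖G w‖ₑ ^ 2) ?_ ?_ ?_ ?_
    · simpa using this
    · intro n
      have := (hed (δ n)).continuous.measurable
      fun_prop
    · intro n
      filter_upwards [ae_restrict_mem hV.measurableSet] with w hw
      rw [← sub_one_mul, enorm_mul, mul_pow]
      gcongr
      rw [← ofReal_norm]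
      refine ENNReal.ofReal_le_ofReal ((norm_sub_le _ _).trans ?_)
      rw [norm_one]
      gcongr
      refine (hle _ (hδ0 n).le w hw).trans ?_
      gcongr
      nlinarith [hδ1 n, sq_nonneg c]
    · rw [lintegral_const_mul' _ _ (by finiteness)]
      exact (ENNReal.mul_lt_top (by finiteness) hfin).ne
    · refine Eventually.of_forall fun w => ?_
      have h1 : Continuous fun δ : ℝ => ‖e δ w * G w - G w‖ₑ ^ 2 := by
        simp only [he]
        fun_prop
      have h2 := (h1.tendsto 0).comp hδlim
      simpa [he, Function.comp_def] using h2
  have hlim2 : Tendsto (fun n => g (δ n)) atTop (𝓝 f) := by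
    rw [tendsto_iff_norm_sub_tendsto_zero]
    have h1 : Tendsto (fun n => ENNReal.ofReal (‖g (δ n) - f‖ ^ 2)) atTop (𝓝 0) := by
      refine hlim.congr fun n => ?_
      rw [← enorm_sq_eq_ofReal, ((hg _ (hδ0 n)).sub hG).enorm_sq h hV]
      rfl
    have h2 := (ENNReal.tendsto_toReal ENNReal.zero_ne_top).comp h1
    have h3 := (Real.continuous_sqrt.tendsto _).comp h2
    simpa [Function.comp_def, ENNReal.toReal_ofReal, Real.sqrt_sq] using h3
  exact mem_closure_of_tendsto hlim2
    (Eventually.of_forall fun n => hmem _ (hδ0 n) _ (hg _ (hδ0 n)))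

/-- Modulated Gaussians on the strip have Gaussian Fourier transforms. -/
theorem exists_paleyWienerRel_gaussian (h : IsConformalPair Φ Ψ (strip (-c) c) (W : Set ℂ))
    (ξ₀ : ℝ) {σ : ℝ} (hσ : 0 < σ) :
    ∃ (f : A2 W) (φ : ℝ → ℂ), PaleyWienerRel Ψ c f φ ∧
      ∀ ξ, ‖φ ξ‖ ^ 2 = Real.exp (-(2 * Real.pi * ((ξ - ξ₀) / σ) ^ 2)) := by
  set b : ℂ := ((σ ^ 2 : ℝ) : ℂ) with hb
  have hb0 : 0 < b.re := by
    rw [hb, Complex.ofReal_re]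
    positivity
  have hbne : b ≠ 0 := fun h0 => by simp [h0] at hb0
  -- The factor `κ` cancels the normalization of the Fourier transform of a Gaussian.
  set κ : ℂ := b ^ (1 / 2 : ℂ) with hκ
  have hκ0 : κ ≠ 0 := by simp [hκ, Complex.cpow_eq_zero_iff, hbne]
  set F : ℂ → ℂ := fun w =>
    Complex.exp (-Real.pi * b * w ^ 2 + 2 * Real.pi * (Complex.I * ξ₀) * w) with hF
  have hFd : Differentiable ℂ F := by fun_prop
  have hπ : 0 < Real.pi * σ ^ 2 := by positivity
  have hbound : ∀ r, ∀ w : ℂ, |w.im| ≤ r → ‖κ * F w‖ ≤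
      ‖κ‖ * (Real.exp (Real.pi * σ ^ 2 * r ^ 2) * Real.exp (2 * Real.pi * |ξ₀| * r))
        * Real.exp (-(Real.pi * σ ^ 2) * w.re ^ 2) := by
    intro r w hw
    have h1 : F w = Complex.exp (-((Real.pi * σ ^ 2 : ℝ) : ℂ) * w ^ 2)
        * Complex.exp (2 * Real.pi * (Complex.I * ξ₀) * w) := by
      simp only [hF]
      rw [← Complex.exp_add]
      congr 1
      rw [hb]
      push_cast
      ring
    have h2 : ‖Complex.exp (2 * Real.pi * (Complex.I * ξ₀) * w)‖
        ≤ Real.exp (2 * Real.pi * |ξ₀| * r) := by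
      rw [Complex.norm_exp, Real.exp_le_exp]
      calc _ = -(2 * Real.pi * ξ₀ * w.im) := by simp
        _ ≤ |2 * Real.pi * ξ₀ * w.im| := neg_le_abs _
        _ = 2 * Real.pi * |ξ₀| * |w.im| := by
          rw [abs_mul, abs_mul, abs_of_pos (by positivity : 0 < 2 * Real.pi)]
        _ ≤ 2 * Real.pi * |ξ₀| * r := by gcongr
    rw [norm_mul, h1, norm_mul]
    calc ‖κ‖ * (‖Complex.exp (-((Real.pi * σ ^ 2 : ℝ) : ℂ) * w ^ 2)‖
          * ‖Complex.exp (2 * Real.pi * (Complex.I * ξ₀) * w)‖)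
        ≤ ‖κ‖ * ((Real.exp (Real.pi * σ ^ 2 * r ^ 2) * Real.exp (-(Real.pi * σ ^ 2) * w.re ^ 2))
          * Real.exp (2 * Real.pi * |ξ₀| * r)) := by
          gcongr
          exact norm_exp_neg_mul_sq_le hπ.le hw
      _ = _ := by ring
  have hGd : DifferentiableOn ℂ (fun w => κ * F w) (strip (-c) c) :=
    (hFd.const_mul κ).differentiableOn
  obtain ⟨f, hf⟩ := exists_of_isLift h (isOpen_strip _ _) hGd
    (lintegral_strip_lt_top hGd hπ fun w hw => hbound c w (mem_strip_symm.1 hw).le)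
  refine ⟨f, _, ⟨_, hf, fun r _ => ⟨_, _, hπ, hbound r⟩, rfl⟩, fun ξ => ?_⟩
  have hFT : 𝓕 (line F 0) = fun t : ℝ => 1 / b ^ (1 / 2 : ℂ)
      * Complex.exp (-Real.pi / b * (t + Complex.I * (Complex.I * ξ₀)) ^ 2) := by
    rw [← fourier_gaussian_pi' hb0]
    congr 1
    ext x
    simp [line, hF]
  rw [fourier_line_const_mul, hFT, Pi.smul_apply, smul_eq_mul, ← mul_assoc, ← hκ,
    mul_one_div_cancel hκ0, one_mul, Complex.norm_exp, ← Real.exp_nat_mul]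
  congr 1
  have h3 : (-Real.pi / b * (ξ + Complex.I * (Complex.I * ξ₀)) ^ 2 : ℂ)
      = ((-(Real.pi * ((ξ - ξ₀) / σ) ^ 2) : ℝ) : ℂ) := by
    have : (ξ + Complex.I * (Complex.I * ξ₀) : ℂ) = ξ - ξ₀ := by
      linear_combination (ξ₀ : ℂ) * Complex.I_sq
    rw [this, hb]
    push_cast
    ring
  rw [h3, Complex.ofReal_re]
  push_cast
  ring

/-- The restriction of Bergman functions to the preimage of a substrip `a < Im w < b` acts in the
Paley–Wiener representation through the weights of the two strips. -/
theorem isSpectralRep (h : IsConformalPair Φ Ψ (strip (-c) c) (W : Set ℂ)) {a b : ℝ}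
    (ha : -c ≤ a) (hab : a < b) (hbc : b ≤ c) {U : TopologicalSpace.Opens ℂ} (hU : U ≤ W)
    (hUX : (U : Set ℂ) = (W : Set ℂ) ∩ Ψ ⁻¹' strip a b) :
    IsSpectralRep (restrictionOp hU) (stripWeight (-c) c) (stripWeight a b)
      (PaleyWienerRel Ψ c) := by
  have hc : 0 < c := by linarith
  have h0 : |(0 : ℝ)| < c := by simpa
  -- Passage from lower Lebesgue integrals to Bochner integrals, including integrability.
  have key : ∀ {x : ℝ} {p q : ℝ} {φ : ℝ → ℂ}, p ≤ q → Continuous φ →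
      ENNReal.ofReal x = ∫⁻ ξ, ‖φ ξ‖ₑ ^ 2 * ENNReal.ofReal (stripWeight p q ξ) → 0 ≤ x →
      Integrable (fun ξ => ‖φ ξ‖ ^ 2 * stripWeight p q ξ) ∧
        ∫ ξ, ‖φ ξ‖ ^ 2 * stripWeight p q ξ = x := by
    intro x p q φ hpq hφ hx hx0
    have hcont := continuous_stripWeight p q
    have hnn : ∀ ξ, 0 ≤ ‖φ ξ‖ ^ 2 * stripWeight p q ξ := fun ξ =>
      mul_nonneg (by positivity) (stripWeight_nonneg hpq ξ)
    have e : ∫⁻ ξ, ‖φ ξ‖ₑ ^ 2 * ENNReal.ofReal (stripWeight p q ξ)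
        = ∫⁻ ξ, ENNReal.ofReal (‖φ ξ‖ ^ 2 * stripWeight p q ξ) := by
      congr 1
      ext ξ
      rw [enorm_sq_eq_ofReal, ENNReal.ofReal_mul (by positivity)]
    rw [e] at hx
    have hm : AEStronglyMeasurable (fun ξ => ‖φ ξ‖ ^ 2 * stripWeight p q ξ) volume := by
      apply Continuous.aestronglyMeasurable
      fun_prop
    refine ⟨⟨hm, ?_⟩, ?_⟩
    · rw [hasFiniteIntegral_iff_ofReal (Eventually.of_forall hnn), ← hx]
      exact ENNReal.ofReal_lt_top
    · rw [integral_eq_lintegral_of_nonneg_ae (Eventually.of_forall hnn) hm, ← hx,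
        ENNReal.toReal_ofReal hx0]
  have hcontφ : ∀ {f : A2 W} {φ : ℝ → ℂ}, PaleyWienerRel Ψ c f φ → Continuous φ := by
    rintro f _ ⟨G, hG, hd, rfl⟩
    exact continuous_fourier_line hG.1 hd h0
  have hnorm : ∀ {f : A2 W} {φ : ℝ → ℂ}, PaleyWienerRel Ψ c f φ →
      ENNReal.ofReal (‖f‖ ^ 2)
        = ∫⁻ ξ, ‖φ ξ‖ₑ ^ 2 * ENNReal.ofReal (stripWeight (-c) c ξ) := by
    rintro f _ ⟨G, hG, hd, rfl⟩
    rw [← enorm_sq_eq_ofReal, hG.enorm_sq h (isOpen_strip _ _),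
      lintegral_strip_enorm_sq hG.1 hd (by linarith) le_rfl le_rfl]
  have hnormU : ∀ {f : A2 W} {φ : ℝ → ℂ}, PaleyWienerRel Ψ c f φ →
      ENNReal.ofReal (‖restrictionOp hU f‖ ^ 2)
        = ∫⁻ ξ, ‖φ ξ‖ₑ ^ 2 * ENNReal.ofReal (stripWeight a b ξ) := by
    rintro f _ ⟨G, hG, hd, rfl⟩
    rw [← enorm_sq_eq_ofReal, hG.enorm_sq_restrictionOp h (X := strip a b)
      (preimage_mono (Ioo_subset_Ioo ha hbc)) (isOpen_strip _ _) hU hUX,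
      lintegral_strip_enorm_sq hG.1 hd hab.le ha hbc]
  exact
  { continuous := hcontφ
    integrable := fun hf => (key (by linarith) (hcontφ hf) (hnorm hf) (by positivity)).1
    norm_sq := fun hf => (key (by linarith) (hcontφ hf) (hnorm hf) (by positivity)).2
    norm_map_sq := fun hf => (key hab.le (hcontφ hf) (hnormU hf) (by positivity)).2
    add := by
      rintro f g _ _ ⟨F, hF, hFd, rfl⟩ ⟨G, hG, hGd, rfl⟩
      exact ⟨F + G, hF.add hG, hFd.add hGd, fourier_line_add (integrable_line hF.1 hFd h0)
        (integrable_line hG.1 hGd h0)⟩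
    sub := by
      rintro f g _ _ ⟨F, hF, hFd, rfl⟩ ⟨G, hG, hGd, rfl⟩
      refine ⟨F - G, hF.sub hG, ?_, ?_⟩
      · rw [sub_eq_add_neg]
        exact hFd.add hGd.neg
      · have hn := fourier_line_const_mul (-1) G
        have e : (fun w => -1 * G w) = -G := by
          ext w
          simp
        rw [e, neg_one_smul] at hn
        rw [sub_eq_add_neg, sub_eq_add_neg, ← hn]
        exact fourier_line_add (integrable_line hF.1 hFd h0)
          (integrable_line hG.1.neg hGd.neg h0)
    dense := dense_paleyWienerRel h
    gaussian := fun ξ₀ σ hσ => exists_paleyWienerRel_gaussian h ξ₀ hσ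
    continuous_s := continuous_stripWeight _ _
    continuous_u := continuous_stripWeight _ _
    pos_s := stripWeight_pos (by linarith)
    nonneg_u := stripWeight_nonneg hab.le
    le_s := stripWeight_mono ha hbc }

end Rep

end Bergman

theorem theorem1p4 :
    (∀ (U : TopologicalSpace.Opens ℂ) (hU : U ≤ Bergman.disc),
      Bergman.IsHypercyclicCrescent (U : Set ℂ) →
        spectrum ℂ (Bergman.toeplitzOp hU) = Complex.ofReal '' Set.Icc 0 1) ∧
    (∀ (U : TopologicalSpace.Opens ℂ) (hU : U ≤ Bergman.disc),
      Bergman.IsHypercyclicLune (U : Set ℂ) →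
        spectrum ℂ (Bergman.toeplitzOp hU) = Complex.ofReal '' Set.Icc 0 ‖Bergman.toeplitzOp hU‖ ∧
        0 < ‖Bergman.toeplitzOp hU‖ ∧ ‖Bergman.toeplitzOp hU‖ < 1) := by
  have hπ := Real.pi_pos
  have hs := Bergman.stripWeight_symm_le (c := Real.pi / 2) (by positivity)
  refine ⟨fun U hU hcr => ?_, fun U hU hlu => ?_⟩
  · obtain ⟨Φ, Ψ, a, h, ha, ha', hUX⟩ := hcr.exists_conformalPair
    exact (Bergman.isSpectralRep h ha.le ha' le_rfl hU hUX).spectrum_eq_of_tendsto_zero_one hs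
      (by positivity) (Bergman.tendsto_stripWeight_div_atTop ha ha'.le le_rfl)
      (Bergman.tendsto_stripWeight_div_atBot_one ha.le ha')
  · obtain ⟨Φ, Ψ, a, b, h, ha, hab, hb, hUX⟩ := hlu.exists_conformalPair
    refine (Bergman.isSpectralRep h ha.le hab hb.le hU hUX).spectrum_eq_of_tendsto_zero_zero hs
      (by positivity) (Bergman.stripWeight_pos hab) (fun ξ => ?_)
      (Bergman.tendsto_stripWeight_div_atTop ha hab.le hb.le)
      (Bergman.tendsto_stripWeight_div_atBot ha.le hab.le hb)
    rw [← Bergman.stripWeight_add _ a (Real.pi / 2), ← Bergman.stripWeight_add a b (Real.pi / 2)]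
    linarith [Bergman.stripWeight_pos ha ξ, Bergman.stripWeight_pos hb ξ]
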